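/- Let $\alpha=\frac{1+i\sqrt7}{2}$, $\mathcal O=\mathbb Z[\alpha]$, and endow $\mathbb C^3$ with $(x,y)=\frac12\sum_i\bar x_iy_i$. Let $\mathcal R\subset\mathbb C^3$ be the set of $42$ vectors obtained from $(2,0,0)$, $(0,\alpha,\alpha)$, $(1,1,\bar\alpha)$ by sign changes and permutations of coordinates, and let $G=G_{336}\subset \mathbf U(3)$ be the group generated by the reflections $r_e:x\mapsto x-(e,x)e$, $e\in\mathcal R$. Let $H=H_{168}=\{h\in G\mid\det h=1\}$, let $$\Lambda=\{z\in\mathcal O^3\mid z_1\equiv z_2\equiv z_3 \bmod \alpha,\ z_1+z_2+z_3\equiv0\bmod\bar\alpha\}$$ (the root lattice of $\mathcal R$, which is $G$-invariant), and $J=\mathbb C^3/\Lambda$, on which $G$ acts. Put $$r_1=\begin{pmatrix}1&0&0\\0&0&1\\0&1&0\end{pmatrix},\quad r_2=\begin{pmatrix}1&0&0\\0&1&0\\0&0&-1\end{pmatrix},\quad r_3=\tfrac12\begin{pmatrix}1&-1&-\alpha\\-1&1&-\alpha\\-\bar\alpha&-\bar\alpha&0\end{pmatrix},$$ $\rho_i=-r_i\in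 H$, $g_7=\rho_1\rho_2\rho_3$, $h_3=\rho_1\rho_3\rho_1\rho_2$ and $G_{21}=\langle g_7,h_3\rangle\subset H$; then $|G_{21}|=21$, $g_7^7=h_3^3=1$ and $h_3g_7h_3^{-1}=g_7^2$. With $e_1=(0,\alpha,\alpha)$, $e_2=(0,0,2)$, $e_3=(1,1,\bar\alpha)$, let $\eta_k\in J$ $(k=1,\dots,6)$ be the class of $$\tfrac k7\bigl(-\alpha e_1-\alpha e_2+\alpha e_3+\bar\alpha e_1+\bar\alpha e_2-\bar\alpha e_3\bigr);$$ these are the six non-zero fixed points of $g_7$ on $J$. Denote by $\frac1d(\nu_1,\nu_2,\nu_3)$ the analytic germ at the image of $0$ of $\mathbb C^3/C_d$, where a generator of the cyclic group $C_d$ of order $d$ acts by $(z_1,z_2,z_3)\mapsto(\epsilon^{\nu_1}z_1,\epsilon^{\nu_2}z_2,\epsilon^{\nu_3}z_3)$, $\epsilon=e^{2\pi i/d}$. **Proposition.** Let $T_7$ be the set of non-zero points of $J$ fixed by some element of order $7$ of $G$. Then $|T_7|=48$, and: i) Every $\eta\in T_7$ is fixed by some $\sigma\in H$ of order $7$, and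 for every such $\sigma$, $\operatorname{Stab}_H(\eta)=\langle\sigma\rangle$ is of order $7$. The set $T_7$ is the disjoint union of two $H$-orbits of length $24$. ii) For every $\sigma\in H$ of order $7$, $N_H(\langle\sigma\rangle)\simeq G_{21}$, and there is an element $\tau$ of order $3$ in $N_H(\langle\sigma\rangle)$ such that $\tau(\eta)=2\eta$ for all $\eta\in T_7$ fixed by $\sigma$. For every $\eta\in T_7$, the points $\eta,2\eta,4\eta$ belong to one of the two $H$-orbits in $T_7$, and $3\eta,5\eta,6\eta$ belong to the other. As representatives of the two orbits one can choose $\eta_1$ and $\eta_3$. iii) The images in $Y=J/H$ of the two $H$-orbits in $T_7$ are two distinct points, each of which is an isolated cyclic quotient singularity of $Y$ of local analytic type $\frac17(1,2,4)$. iv) The action of $-1$ permutes the two $H$-orbits in $T_7$; $T_7$ is one $G$-orbit, and its image in $X=J/G$ is a single point, an isolated singularity of $X$ of local analytic type $\frac17(1,2,4)$. -/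

import Mathlib

open scoped Matrix ComplexConjugate Topology

namespace KleinQuotient

noncomputable section

/-! ### The ring `𝓞 = ℤ[α]`, the root system and the root lattice -/

/-- The vector space `ℂ³`, with its standard coordinates. -/
abbrev V : Type := Fin 3 → ℂ

/-- `α = (1 + i√7) / 2`. -/
def α : ℂ := (1 + Complex.I * (Real.sqrt 7 : ℂ)) / 2

theorem α_sq : α * α = α - 2 := by
  have h7 : ((Real.sqrt 7 : ℝ) : ℂ) * (Real.sqrt 7 : ℝ) = 7 := by
    rw [← Complex.ofReal_mul, Real.mul_self_sqrt (by norm_num)]; norm_num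
  have hI : Complex.I * Complex.I = -1 := Complex.I_mul_I
  unfold α
  linear_combination (1 / 4) * (Real.sqrt 7 : ℂ) * (Real.sqrt 7 : ℂ) * hI - (1 / 4) * h7

theorem conj_α : conj α = 1 - α := by
  unfold α
  simp only [map_div₀, map_add, map_mul, map_one, Complex.conj_I, Complex.conj_ofReal, map_ofNat]
  ring

/-- The ring `𝓞 = ℤ + ℤα`, the ring of integers of `ℚ(√-7)`. -/
def O : Subring ℂ where
  carrier := {x | ∃ a b : ℤ, x = a + b * α}
  zero_mem' := ⟨0, 0, by simp⟩
  one_mem' := ⟨1, 0, by simp⟩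
  add_mem' := by
    rintro _ _ ⟨a, b, rfl⟩ ⟨c, d, rfl⟩
    exact ⟨a + c, b + d, by push_cast; ring⟩
  neg_mem' := by
    rintro _ ⟨a, b, rfl⟩
    exact ⟨-a, -b, by push_cast; ring⟩
  mul_mem' := by
    rintro _ _ ⟨a, b, rfl⟩ ⟨c, d, rfl⟩
    exact ⟨a * c - 2 * b * d, a * d + b * c + b * d, by
      push_cast; linear_combination (b : ℂ) * d * α_sq⟩

theorem α_mem : α ∈ O := ⟨0, 1, by simp⟩

theorem conj_α_mem : conj α ∈ O := by
  rw [conj_α]; exact O.sub_mem O.one_mem α_mem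

/-- The root system of 42 roots: the vectors obtained from `(2,0,0)`, `(0,α,α)`, `(1,1,ᾱ)` by
sign changes and permutations of the coordinates. -/
def roots : Set V :=
  {x | ∃ v ∈ ({![2, 0, 0], ![0, α, α], ![1, 1, conj α]} : Set V),
    ∃ (p : Equiv.Perm (Fin 3)) (s : Fin 3 → ℤˣ), ∀ i, x i = ((s i : ℤ) : ℂ) * v (p i)}

/-- The root lattice `Λ = {z ∈ 𝓞³ | z₁ ≡ z₂ ≡ z₃ mod α, z₁ + z₂ + z₃ ≡ 0 mod ᾱ}`. -/
def Λ : AddSubgroup V where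
  carrier := {z | (∀ i, z i ∈ O) ∧ (∀ i j, ∃ w ∈ O, z i - z j = α * w) ∧
    ∃ w ∈ O, z 0 + z 1 + z 2 = conj α * w}
  zero_mem' := ⟨fun _ => O.zero_mem, fun _ _ => ⟨0, O.zero_mem, by simp⟩,
    ⟨0, O.zero_mem, by simp⟩⟩
  add_mem' := by
    rintro x y ⟨hx, hx', u, hu, hxu⟩ ⟨hy, hy', v, hv, hyv⟩
    refine ⟨fun i => O.add_mem (hx i) (hy i), fun i j => ?_, u + v, O.add_mem hu hv, ?_⟩
    · obtain ⟨a, ha, hxa⟩ := hx' i j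
      obtain ⟨b, hb, hyb⟩ := hy' i j
      exact ⟨a + b, O.add_mem ha hb, by
        simp only [Pi.add_apply]; linear_combination hxa + hyb⟩
    · simp only [Pi.add_apply]; linear_combination hxu + hyv
  neg_mem' := by
    rintro x ⟨hx, hx', u, hu, hxu⟩
    refine ⟨fun i => O.neg_mem (hx i), fun i j => ?_, -u, O.neg_mem hu, ?_⟩
    · obtain ⟨a, ha, hxa⟩ := hx' i j
      exact ⟨-a, O.neg_mem ha, by simp only [Pi.neg_apply]; linear_combination -hxa⟩
    · simp only [Pi.neg_apply]; linear_combination -hxu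

/-- The Hermitian product `(x, y) = ½ ∑ x̄ᵢ yᵢ`. -/
def herm (x y : V) : ℂ := (1 / 2) * ∑ i, conj (x i) * y i

/-- The reflection `r_e : x ↦ x - (e, x) e`. -/
def refl (e x : V) : V := x - herm e x • e

theorem two_eq : (2 : ℂ) = α * conj α := by
  rw [conj_α]; linear_combination α_sq

theorem smul_mem_Λ {c : ℂ} (hc : c ∈ O) {z : V} (hz : z ∈ Λ) : c • z ∈ Λ := by
  obtain ⟨h1, h2, u, hu, h3⟩ := hz
  refine ⟨fun i => O.mul_mem hc (h1 i), fun i j => ?_, c * u, O.mul_mem hc hu, ?_⟩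
  · obtain ⟨a, ha, h⟩ := h2 i j
    exact ⟨c * a, O.mul_mem hc ha, by
      simp only [Pi.smul_apply, smul_eq_mul]; linear_combination c * h⟩
  · simp only [Pi.smul_apply, smul_eq_mul]; linear_combination c * h3

theorem perm_mem_Λ (p : Equiv.Perm (Fin 3)) {z : V} (hz : z ∈ Λ) : (fun i => z (p i)) ∈ Λ := by
  obtain ⟨h1, h2, u, hu, h3⟩ := hz
  refine ⟨fun i => h1 _, fun i j => h2 _ _, u, hu, ?_⟩
  have := Equiv.sum_comp p z
  simp only [Fin.sum_univ_three] at this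
  rw [this, h3]

theorem sign_mem_Λ (s : Fin 3 → ℤˣ) {z : V} (hz : z ∈ Λ) :
    (fun i => ((s i : ℤ) : ℂ) * z i) ∈ Λ := by
  obtain ⟨h1, h2, u, hu, h3⟩ := hz
  have hs : ∀ i, ∃ t ∈ O, ((s i : ℤ) : ℂ) * z i = z i + 2 * t := by
    intro i
    rcases Int.units_eq_one_or (s i) with h | h
    · exact ⟨0, O.zero_mem, by simp [h]⟩
    · exact ⟨-z i, O.neg_mem (h1 i), by simp [h]; ring⟩
  choose t ht hst using hs
  refine ⟨fun i => ?_, fun i j => ?_,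
    u + α * (t 0 + t 1 + t 2), O.add_mem hu (O.mul_mem α_mem
      (O.add_mem (O.add_mem (ht 0) (ht 1)) (ht 2))), ?_⟩
  · exact O.mul_mem (intCast_mem O _) (h1 i)
  · obtain ⟨a, ha, h⟩ := h2 i j
    refine ⟨a + conj α * (t i - t j), O.add_mem ha (O.mul_mem conj_α_mem
      (O.sub_mem (ht i) (ht j))), ?_⟩
    simp only [hst]
    linear_combination h + (t i - t j) * two_eq
  · simp only [hst]
    linear_combination h3 + (t 0 + t 1 + t 2) * two_eq

theorem roots_subset_Λ {e : V} (he : e ∈ roots) : e ∈ Λ := by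
  obtain ⟨v, hv, p, s, h⟩ := he
  have hvΛ : v ∈ Λ := by
    have pairs : ∀ (z : V) (a b : ℂ), a ∈ O → b ∈ O → z 0 - z 1 = α * a → z 1 - z 2 = α * b →
        ∀ i j, ∃ w ∈ O, z i - z j = α * w := by
      intro z a b ha hb h01 h12
      have hz : ∀ i, ∃ w ∈ O, z i - z 2 = α * w := by
        intro i
        fin_cases i
        · exact ⟨a + b, O.add_mem ha hb, by
            simp only [Fin.zero_eta]; linear_combination h01 + h12⟩
        · exact ⟨b, hb, h12⟩
        · exact ⟨0, O.zero_mem, by simp⟩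
      intro i j
      obtain ⟨u, hu, hu'⟩ := hz i
      obtain ⟨v, hv, hv'⟩ := hz j
      exact ⟨u - v, O.sub_mem hu hv, by linear_combination hu' - hv'⟩
    have m0 := O.zero_mem
    have m1 := O.one_mem
    have m2 := α_mem
    have m3 := conj_α_mem
    simp only [Set.mem_insert_iff, Set.mem_singleton_iff] at hv
    rcases hv with rfl | rfl | rfl
    · refine ⟨fun i => by fin_cases i <;> simp [m0], pairs _ (conj α) 0 m3 m0 ?_ ?_, α, m2, ?_⟩
      · simpa using two_eq
      · simp
      · simpa [mul_comm] using two_eq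
    · refine ⟨fun i => by fin_cases i <;> simp [m0, m2], pairs _ (-1) 0 (O.neg_mem m1) m0 ?_ ?_,
        α * α, O.mul_mem m2 m2, ?_⟩
      · simp
      · simp
      · simp only [Matrix.cons_val]
        linear_combination α * two_eq
    · refine ⟨fun i => by fin_cases i <;> simp [m1, m3], pairs _ 0 1 m0 m1 ?_ ?_,
        1 + α, O.add_mem m1 m2, ?_⟩
      · simp
      · simp only [Matrix.cons_val]
        linear_combination -conj_α
      · simp only [Matrix.cons_val]
        linear_combination two_eq
  have := sign_mem_Λ s (perm_mem_Λ p hvΛ)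
  convert this using 1
  exact funext h

theorem herm_mem {e z : V} (he : e ∈ roots) (hz : z ∈ Λ) : herm e z ∈ O := by
  obtain ⟨v, hv, p, s, h⟩ := he
  have key : herm e z = herm v (fun i => ((s (p.symm i) : ℤ) : ℂ) * z (p.symm i)) := by
    unfold herm
    rw [← Equiv.sum_comp p (fun i => conj (v i) * _)]
    simp only [h, map_mul, map_intCast, Equiv.symm_apply_apply]
    congr 1
    exact Finset.sum_congr rfl fun i _ => by ring
  have hy := perm_mem_Λ p.symm (sign_mem_Λ s hz)
  rw [key]
  generalize (fun i => ((s (p.symm i) : ℤ) : ℂ) * z (p.symm i)) = y at hy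
  obtain ⟨h1, h2, u, hu, h3⟩ := hy
  simp only [Set.mem_insert_iff, Set.mem_singleton_iff] at hv
  rcases hv with rfl | rfl | rfl
  · have : herm ![2, 0, 0] y = y 0 := by
      simp [herm, Fin.sum_univ_three, Complex.conj_ofNat]
    rw [this]; exact h1 0
  · obtain ⟨w, hw, h⟩ := h2 1 2
    have : herm ![0, α, α] y = conj α * y 2 + w := by
      simp only [herm, Fin.sum_univ_three, Matrix.cons_val, map_zero]
      linear_combination (1 / 2) * conj α * h - (1 / 2) * w * two_eq
    rw [this]; exact O.add_mem (O.mul_mem conj_α_mem (h1 2)) hw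
  · obtain ⟨w, hw, h⟩ := h2 0 1
    have : herm ![1, 1, conj α] y = y 1 + u - α * y 1 + w := by
      simp only [herm, Fin.sum_univ_three, Matrix.cons_val, map_one, Complex.conj_conj]
      have hc := conj_α
      rw [conj_α] at h3
      grind [α_sq]
    rw [this]
    exact O.add_mem (O.sub_mem (O.add_mem (h1 1) hu) (O.mul_mem α_mem (h1 1))) hw

theorem refl_mem_Λ {e z : V} (he : e ∈ roots) (hz : z ∈ Λ) : refl e z ∈ Λ :=
  Λ.sub_mem hz (smul_mem_Λ (herm_mem he hz) (roots_subset_Λ he))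

/-! ### The groups `G₃₃₆` and `H₁₆₈` -/

/-- The complex reflection group `G = G₃₃₆ ⊂ U(3)`, generated by the reflections in the roots. -/
def G336 : Subgroup (Matrix.unitaryGroup (Fin 3) ℂ) :=
  Subgroup.closure {g | ∃ e ∈ roots, ∀ x : V, (g : Matrix (Fin 3) (Fin 3) ℂ) *ᵥ x = refl e x}

/-- The determinant as a character of `G₃₃₆`. -/
def detG : G336 →* ℂ :=
  Matrix.detMonoidHom.comp
    ((Matrix.unitaryGroup (Fin 3) ℂ).subtype.comp G336.subtype)

/-- Klein's simple group `H₁₆₈ = {h ∈ G | det h = 1}`. -/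
def H168 : Subgroup G336 := detG.ker

theorem herm_self {e : V} (he : e ∈ roots) : herm e e = 2 := by
  obtain ⟨v, hv, p, s, h⟩ := he
  have hs : ∀ i, ((s i : ℤ) : ℂ) * ((s i : ℤ) : ℂ) = 1 := by
    intro i
    rcases Int.units_eq_one_or (s i) with h | h <;> simp [h]
  have key : herm e e = herm v v := by
    unfold herm
    rw [← Equiv.sum_comp p (fun i => conj (v i) * v i)]
    simp only [h, map_mul, map_intCast]
    congr 1
    exact Finset.sum_congr rfl fun i _ => by
      linear_combination conj (v (p i)) * v (p i) * hs i
  rw [key]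
  simp only [Set.mem_insert_iff, Set.mem_singleton_iff] at hv
  rcases hv with rfl | rfl | rfl <;>
    simp only [herm, Fin.sum_univ_three, Matrix.cons_val, map_zero, map_one, Complex.conj_conj,
      Complex.conj_ofNat]
  · norm_num
  · linear_combination -two_eq
  · linear_combination -(1 / 2) * two_eq

theorem herm_refl {e : V} (he : e ∈ roots) (z : V) : herm e (refl e z) = -herm e z := by
  have h1 : herm e (refl e z) = herm e z - herm e z * herm e e := by
    simp only [herm, refl, Fin.sum_univ_three, Pi.sub_apply, Pi.smul_apply, smul_eq_mul]
    ring
  rw [h1, herm_self he]; ring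

theorem refl_refl {e : V} (he : e ∈ roots) (z : V) : refl e (refl e z) = z := by
  rw [refl, herm_refl he]
  simp [refl]

theorem mulVec_mem_Λ (g : G336) {z : V} (hz : z ∈ Λ) :
    ((g : Matrix.unitaryGroup (Fin 3) ℂ) : Matrix (Fin 3) (Fin 3) ℂ) *ᵥ z ∈ Λ := by
  obtain ⟨g, hg⟩ := g
  revert z
  change ∀ {z : V}, z ∈ Λ → (g : Matrix (Fin 3) (Fin 3) ℂ) *ᵥ z ∈ Λ
  induction hg using Subgroup.closure_induction_left with
  | one => intro z hz; simpa using hz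
  | mul_left x hx y hy ih =>
    intro z hz
    obtain ⟨e, he, h⟩ := hx
    rw [Submonoid.coe_mul, ← Matrix.mulVec_mulVec, h]
    exact refl_mem_Λ he (ih hz)
  | inv_mul_cancel x hx y hy ih =>
    intro z hz
    obtain ⟨e, he, h⟩ := hx
    have hinv : ∀ w : V, ((x⁻¹ : Matrix.unitaryGroup (Fin 3) ℂ) : Matrix (Fin 3) (Fin 3) ℂ) *ᵥ w =
        refl e w := by
      intro w
      conv_lhs => rw [← refl_refl he w, ← h, Matrix.mulVec_mulVec, ← Submonoid.coe_mul]
      simp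
    rw [Submonoid.coe_mul, ← Matrix.mulVec_mulVec, hinv]
    exact refl_mem_Λ he (ih hz)

/-! ### The complex torus `J = ℂ³ / Λ` and the action of `G` -/

/-- The complex torus `J = ℂ³ / Λ`, with the quotient topology. -/
abbrev J : Type := V ⧸ Λ

/-- The linear action of `G` on `ℂ³` descends to an action by group automorphisms of `J`. -/
instance instActionJ : DistribMulAction G336 J where
  smul g := QuotientAddGroup.map Λ Λ
    (Matrix.mulVecLin ((g : Matrix.unitaryGroup (Fin 3) ℂ) :
      Matrix (Fin 3) (Fin 3) ℂ)).toAddMonoidHom (fun _ hz => mulVec_mem_Λ g hz)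
  one_smul x := by
    induction x using QuotientAddGroup.induction_on with
    | H z => exact congrArg _ (Matrix.one_mulVec z)
  mul_smul g h x := by
    induction x using QuotientAddGroup.induction_on with
    | H z => exact congrArg _ (Matrix.mulVec_mulVec z _ _).symm
  smul_zero g := map_zero (QuotientAddGroup.map Λ Λ _ _)
  smul_add g x y := map_add (QuotientAddGroup.map Λ Λ _ _) x y

theorem smul_mk (g : G336) (z : V) :
    g • (z : J) = ((((g : Matrix.unitaryGroup (Fin 3) ℂ) :
      Matrix (Fin 3) (Fin 3) ℂ) *ᵥ z : V) : J) := rfl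

/-! ### Explicit elements -/

/-- The matrix of the reflection `r_e`. -/
def reflMat (e : V) : Matrix (Fin 3) (Fin 3) ℂ :=
  1 - (1 / 2 : ℂ) • Matrix.vecMulVec e (star e)

theorem reflMat_mulVec (e x : V) : reflMat e *ᵥ x = refl e x := by
  ext i
  simp only [reflMat, refl, herm, Matrix.sub_mulVec, Matrix.one_mulVec, Matrix.smul_mulVec,
    Matrix.vecMulVec_mulVec, Pi.sub_apply, Pi.smul_apply, dotProduct, Pi.star_apply,
    starRingEnd_apply, smul_eq_mul, MulOpposite.smul_eq_mul_unop, MulOpposite.unop_op]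
  ring

theorem reflMat_mem {e : V} (he : e ∈ roots) : reflMat e ∈ Matrix.unitaryGroup (Fin 3) ℂ := by
  have hs : star (reflMat e) = reflMat e := by
    ext i j
    simp [reflMat, Matrix.star_apply, Matrix.vecMulVec_apply, Matrix.one_apply, eq_comm, mul_comm]
  rw [Matrix.mem_unitaryGroup_iff, hs]
  refine Matrix.mulVec_injective (funext fun x => ?_)
  rw [← Matrix.mulVec_mulVec, reflMat_mulVec, reflMat_mulVec, refl_refl he, Matrix.one_mulVec]

/-- The reflection `r_e` in a root `e`, as an element of `G`. -/
def rootRefl (e : V) (he : e ∈ roots) : G336 :=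
  ⟨⟨reflMat e, reflMat_mem he⟩, Subgroup.subset_closure ⟨e, he, reflMat_mulVec e⟩⟩

theorem root₁ : ![0, α, -α] ∈ roots :=
  ⟨_, Or.inr (Or.inl rfl), 1, ![1, 1, -1], fun i => by fin_cases i <;> simp⟩

theorem root₂ : ![0, 0, 2] ∈ roots :=
  ⟨_, Or.inl rfl, Equiv.swap 0 2, 1, fun i => by fin_cases i <;> simp [Equiv.swap_apply_def]⟩

theorem root₃ : ![1, 1, conj α] ∈ roots :=
  ⟨_, Or.inr (Or.inr rfl), 1, 1, fun i => by fin_cases i <;> simp⟩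

/-- `r₁` exchanges the second and the third coordinate: it is the reflection in `(0, α, -α)`. -/
def r₁ : G336 := rootRefl _ root₁

/-- `r₂` changes the sign of the third coordinate. -/
def r₂ : G336 := rootRefl _ root₂

/-- `r₃` is the reflection in `(1, 1, ᾱ)`. -/
def r₃ : G336 := rootRefl _ root₃

/-- The matrix of an element of `G`. -/
def mat (g : G336) : Matrix (Fin 3) (Fin 3) ℂ := (g : Matrix.unitaryGroup (Fin 3) ℂ)

theorem reflMat_apply (e : V) (i j : Fin 3) :
    reflMat e i j = (if i = j then 1 else 0) - (1 / 2) * (e i * conj (e j)) := by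
  simp [reflMat, Matrix.vecMulVec_apply, Matrix.one_apply]

theorem mat_r₁ : mat r₁ = !![1, 0, 0; 0, 0, 1; 0, 1, 0] := by
  have h := two_eq
  ext i j
  change reflMat _ i j = _
  rw [reflMat_apply]
  fin_cases i <;> fin_cases j <;> simp <;>
    first
      | linear_combination (1 / 2) * h
      | linear_combination -(1 / 2) * h

theorem mat_r₂ : mat r₂ = !![1, 0, 0; 0, 1, 0; 0, 0, -1] := by
  ext i j
  change reflMat _ i j = _
  rw [reflMat_apply]
  fin_cases i <;> fin_cases j <;> simp [Complex.conj_ofNat]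
  norm_num

theorem mat_r₃ : mat r₃ =
    !![1 / 2, -1 / 2, -α / 2; -1 / 2, 1 / 2, -α / 2; -conj α / 2, -conj α / 2, 0] := by
  have h := two_eq
  ext i j
  change reflMat _ i j = _
  rw [reflMat_apply]
  fin_cases i <;> fin_cases j <;> simp <;>
    first
      | linear_combination (1 / 2) * h
      | ring

theorem mat_mul (g h : G336) : mat (g * h) = mat g * mat h := rfl

theorem det_r₁ : detG r₁ = -1 := by
  change (mat r₁).det = -1
  rw [mat_r₁]; simp [Matrix.det_fin_three]

theorem det_r₂ : detG r₂ = -1 := by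
  change (mat r₂).det = -1
  rw [mat_r₂]; simp [Matrix.det_fin_three]

theorem det_r₃ : detG r₃ = -1 := by
  change (mat r₃).det = -1
  rw [mat_r₃]; simp [Matrix.det_fin_three]
  linear_combination (1 / 2) * two_eq

theorem mat_r₁r₂r₃ : mat (r₁ * r₂ * r₃) =
    !![1 / 2, -1 / 2, -α / 2; conj α / 2, conj α / 2, 0; -1 / 2, 1 / 2, -α / 2] := by
  rw [mat_mul, mat_mul, mat_r₁, mat_r₂, mat_r₃]
  ext i j
  fin_cases i <;> fin_cases j <;> simp [Matrix.mul_apply, Fin.sum_univ_three] <;> ring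

theorem mat_pow_two : mat ((r₁ * r₂ * r₃) ^ 2) =
    !![α / 2, -1 / 2, -1 / 2; -α / 2, -1 / 2, -1 / 2; 0, (1 - α) / 2, (α - 1) / 2] := by
  rw [pow_two, mat_mul, mat_r₁r₂r₃, conj_α]
  ext i j
  fin_cases i <;> fin_cases j <;> simp [Matrix.mul_apply, Fin.sum_univ_three] <;>
    first
      | ring1
      | linear_combination (1 / 4) * α_sq

theorem mat_pow_three : mat ((r₁ * r₂ * r₃) ^ 3) =
    !![α / 2, -1 / 2, 1 / 2; 0, (α - 1) / 2, (α - 1) / 2; -α / 2, -1 / 2, 1 / 2] := by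
  rw [pow_succ, mat_mul, mat_pow_two, mat_r₁r₂r₃, conj_α]
  ext i j
  fin_cases i <;> fin_cases j <;> simp [Matrix.mul_apply, Fin.sum_univ_three] <;>
    first
      | ring1
      | linear_combination (1 / 4) * α_sq
      | linear_combination -(1 / 4) * α_sq

theorem mat_pow_four : mat ((r₁ * r₂ * r₃) ^ 4) =
    !![(α - 1) / 2, 0, (1 - α) / 2; 1 / 2, α / 2, 1 / 2; -1 / 2, α / 2, -1 / 2] := by
  rw [show 4 = 2 + 2 from rfl, pow_add, mat_mul, mat_pow_two]
  ext i j
  fin_cases i <;> fin_cases j <;> simp [Matrix.mul_apply, Fin.sum_univ_three] <;>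
    first
      | ring1
      | linear_combination (1 / 4) * α_sq
      | linear_combination -(1 / 4) * α_sq

theorem mat_pow_seven : mat ((r₁ * r₂ * r₃) ^ 7) = -1 := by
  rw [show 7 = 3 + 4 from rfl, pow_add, mat_mul, mat_pow_three, mat_pow_four]
  ext i j
  fin_cases i <;> fin_cases j <;> simp [Matrix.mul_apply, Fin.sum_univ_three] <;>
    first
      | ring1
      | linear_combination (1 / 4) * α_sq
      | linear_combination -(1 / 4) * α_sq
      | linear_combination (1 / 2) * α_sq

theorem neg_one_mem : -1 ∈ G336 := by
  have : (((r₁ * r₂ * r₃) ^ 7 : G336) : Matrix.unitaryGroup (Fin 3) ℂ) = -1 :=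
    Subtype.ext mat_pow_seven
  rw [← this]
  exact ((r₁ * r₂ * r₃) ^ 7 : G336).2

/-- `-1 ∈ G`. -/
def negOne : G336 := ⟨-1, neg_one_mem⟩

theorem negOne_smul (x : J) : negOne • x = -x := by
  induction x using QuotientAddGroup.induction_on with
  | H z =>
    rw [smul_mk, ← QuotientAddGroup.mk_neg]
    exact congrArg _ ((Matrix.neg_mulVec z 1).trans (by rw [Matrix.one_mulVec]))

theorem det_negOne : detG negOne = -1 := by
  change (-1 : Matrix (Fin 3) (Fin 3) ℂ).det = -1
  simp [Matrix.det_neg]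
  norm_num

/-- The antireflection `ρ₁ = -r₁` in `H₁₆₈`. -/
def ρ₁ : H168 := ⟨negOne * r₁, by rw [H168, MonoidHom.mem_ker, map_mul, det_negOne, det_r₁]; simp⟩

/-- The antireflection `ρ₂ = -r₂` in `H₁₆₈`. -/
def ρ₂ : H168 := ⟨negOne * r₂, by rw [H168, MonoidHom.mem_ker, map_mul, det_negOne, det_r₂]; simp⟩

/-- The antireflection `ρ₃ = -r₃` in `H₁₆₈`. -/
def ρ₃ : H168 := ⟨negOne * r₃, by rw [H168, MonoidHom.mem_ker, map_mul, det_negOne, det_r₃]; simp⟩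

/-- The element `g₇ = ρ₁ρ₂ρ₃`. -/
def g₇ : H168 := ρ₁ * ρ₂ * ρ₃

/-- The element `h₃ = ρ₁ρ₃ρ₁ρ₂`. -/
def h₃ : H168 := ρ₁ * ρ₃ * ρ₁ * ρ₂

/-- The group `G₂₁ = ⟨g₇, h₃⟩`. -/
def G21 : Subgroup H168 := Subgroup.closure {g₇, h₃}

/-! ### Points of `J` fixed by elements of order 7 -/

/-- The set `T₇` of non-zero points of `J` fixed by elements of order 7. -/
def T7 : Set J := {x | x ≠ 0 ∧ ∃ g : G336, orderOf g = 7 ∧ g • x = x}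

/-- The root `e₁ = (0,α,α)`. Together, `e₁, e₂, e₃` form an `𝓞`-basis of `Λ`. -/
def e₁ : V := ![0, α, α]

/-- The root `e₂ = (0,0,2)`. -/
def e₂ : V := ![0, 0, 2]

/-- The root `e₃ = (1,1,ᾱ)`. -/
def e₃ : V := ![1, 1, conj α]

/-- The point `η_k ∈ J`, the class of `(k/7)(-ε₁ - ε₂ + ε₃ + ε₄ + ε₅ - ε₆)`, where
`(ε₁, …, ε₆) = (αe₁, αe₂, αe₃, ᾱe₁, ᾱe₂, ᾱe₃)`. -/
def η (k : ℕ) : J :=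
  (((k : ℂ) / 7) • (-(α • e₁) - α • e₂ + α • e₃ + conj α • e₁ + conj α • e₂ - conj α • e₃) : V)

/-! ### Quotient spaces, germs and singularities

A reduced complex space is described by its topological space together with the datum of which
functions on which open subsets are holomorphic. -/

/-- The datum, on a space `X`, of the holomorphic functions on each open subset `U`:
`S U f` says that `f` is holomorphic on `U`. -/
abbrev HolStructure (X : Type*) : Type _ := Set X → (X → ℂ) → Prop

/-- The standard holomorphic functions on `ℂⁿ`. -/
def stdHol (n : ℕ) : HolStructure (Fin n → ℂ) := fun U f => DifferentiableOn ℂ f U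

/-- The structure of a quotient `q : X → Y`: a function on an open subset of `Y` is holomorphic iff
its pullback to `X` is. -/
def HolStructure.quotient {X Y : Type*} (S : HolStructure X) (q : X → Y) : HolStructure Y :=
  fun U f => S (q ⁻¹' U) (f ∘ q)

/-- The germs of `(X, S)` at `p` and of `(Y, T)` at `q` are isomorphic: there is a homeomorphism `φ`
from an open neighbourhood of `p` onto an open neighbourhood of `q` with `φ p = q` that identifies
the holomorphic functions. -/
def GermIso {X Y : Type*} [TopologicalSpace X] [TopologicalSpace Y]
    (S : HolStructure X) (p : X) (T : HolStructure Y) (q : Y) : Prop :=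
  ∃ φ : OpenPartialHomeomorph X Y, p ∈ φ.source ∧ φ p = q ∧
    ∀ (U : Set Y) (f : Y → ℂ), IsOpen U → U ⊆ φ.target →
      (T U f ↔ S (φ.source ∩ φ ⁻¹' U) (f ∘ φ))

/-- The point `p` is nonsingular: its germ is that of some `ℂⁿ` at the origin. -/
def IsNonsingularAt {X : Type*} [TopologicalSpace X] (S : HolStructure X) (p : X) : Prop :=
  ∃ n : ℕ, GermIso S p (stdHol n) 0

/-- The point `p` is an isolated singularity: it is singular, and all the other points of some
neighbourhood of it are nonsingular. -/
def IsIsolatedSingularity {X : Type*} [TopologicalSpace X] (S : HolStructure X) (p : X) : Prop :=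
  ¬ IsNonsingularAt S p ∧ ∀ᶠ x in 𝓝[≠] p, IsNonsingularAt S x

/-- The orbit relation on `ℂ³` of the cyclic group of order `d` whose generator acts by
`(z₁, z₂, z₃) ↦ (ε^ν₁ z₁, ε^ν₂ z₂, ε^ν₃ z₃)`, `ε = exp(2πi/d)`. -/
def cyclicSetoid (d : ℕ) (ν : Fin 3 → ℤ) : Setoid V where
  r z w := ∃ k : ℤ, ∀ i, w i = (Complex.exp (2 * Real.pi * Complex.I / d) ^ ν i) ^ k * z i
  iseqv :=
    { refl := fun z => ⟨0, fun i => by simp⟩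
      symm := by
        rintro z w ⟨k, h⟩
        refine ⟨-k, fun i => ?_⟩
        have h0 : (Complex.exp (2 * Real.pi * Complex.I / d) ^ ν i) ^ k ≠ 0 :=
          zpow_ne_zero _ (zpow_ne_zero _ (Complex.exp_ne_zero _))
        rw [h i, zpow_neg, inv_mul_cancel_left₀ h0]
      trans := by
        rintro z w u ⟨k, h⟩ ⟨l, h'⟩
        refine ⟨l + k, fun i => ?_⟩
        have h0 : Complex.exp (2 * Real.pi * Complex.I / d) ^ ν i ≠ 0 :=
          zpow_ne_zero _ (Complex.exp_ne_zero _)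
        rw [h' i, h i, zpow_add₀ h0]; ring }

/-- The quotient `ℂ³ / C_d`, with the quotient topology. -/
abbrev CyclicQuotient (d : ℕ) (ν : Fin 3 → ℤ) : Type := Quotient (cyclicSetoid d ν)

/-- The holomorphic functions on `ℂ³ / C_d`. -/
def cyclicHol (d : ℕ) (ν : Fin 3 → ℤ) : HolStructure (CyclicQuotient d ν) :=
  (stdHol 3).quotient (Quotient.mk (cyclicSetoid d ν))

/-- The germ at `p` is of local analytic type `(1/d)(ν₁, ν₂, ν₃)`. -/
def IsCyclicQuotientType {X : Type*} [TopologicalSpace X] (S : HolStructure X) (p : X)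
    (d : ℕ) (ν : Fin 3 → ℤ) : Prop :=
  GermIso S p (cyclicHol d ν) (Quotient.mk (cyclicSetoid d ν) 0)

/-- The holomorphic functions on `J`. -/
def holJ : HolStructure J := (stdHol 3).quotient (QuotientAddGroup.mk : V → J)

/-- The quotient `Y = J / H₁₆₈`, with the quotient topology. -/
abbrev Y : Type := MulAction.orbitRel.Quotient H168 J

/-- The natural map `J → Y`. -/
def πY (x : J) : Y := Quotient.mk (MulAction.orbitRel H168 J) x

/-- The holomorphic functions on `Y`. -/
def holY : HolStructure Y := holJ.quotient πY

/-- The quotient `X = J / G₃₃₆`, with the quotient topology. -/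
abbrev X : Type := MulAction.orbitRel.Quotient G336 J

/-- The natural map `J → X`. -/
def πX (x : J) : X := Quotient.mk (MulAction.orbitRel G336 J) x

/-- The holomorphic functions on `X`. -/
def holX : HolStructure X := holJ.quotient πX

end

end KleinQuotient

open KleinQuotient

/-!
The group `G` permutes the 42 vectors `z ∈ Λ` with `(z, z) = 2`, among which are the vectors
`e₁, e₂, e₃` of an `𝓞`-basis of `Λ`. Counting the possible images of this basis shows that `G` is
finite of order at most 336, and therefore that `H` has order at most 168
(`finite_G336_and_card_le`, `card_H168_le`).

In that basis, `√-7 (g₇ - 1)⁻¹` is integral, and of rank one modulo `√-7`; hence the points of `J`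
fixed by `g₇` are the multiples of `η₁` (`exists_zsmul_η_of_g₇_smul`). The element `h₃` doubles
them, while `ρ₁` takes the nonzero ones to points that `g₇` moves. For such a point `x`, these facts
leave 3 or 6 fixed points of `g₇` in the `H`-orbit of `x`, a number congruent modulo 7 to the length
of the orbit and smaller than it; since 42 divides the order of `H`, the orbit has length 24, the
stabilizer of `x` has order 7, the order of `H` is 168, and `-x` is in another orbit
(`orbit_of_g₇_smul_eq`). By Sylow's theorem, every point of `T₇` is in the `H`-orbit of a fixed
point of `g₇`, from which the statements on orbits, stabilizers and normalizers follow.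

For the singularities, two quotients of `ℂ³` whose projections have the same fibres near a point
have isomorphic germs there (`germIso_of_fibers`). Since `g₇` generates the stabilizer of its fixed
point and has the eigenvalues `ζ, ζ², ζ⁴` for a primitive seventh root of unity `ζ`, the germ is
that of `(1/7)(1, 2, 4)` (`germIso_orbit_cyclic`). The cyclic group acts freely outside the
origin, so the singularity is isolated if the origin is singular at all. In a smooth chart at the
origin there would be three coordinates, and then the four invariant monomials `xyz, xy³, x³z, x³y²`
would have linearly dependent differentials. On the curves `t ↦ (v₀t, v₁t², v₂t⁴)`, the coordinates
are invariant under multiplication of `t` by seventh roots of unity, hence `O(t⁷)`; so a combination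
of the monomials would be `o(t⁷)` there, although it is homogeneous of degree 7 in `t`
(`not_isNonsingularAt_cyclic`).
-/

namespace KleinQuotient

/-! ### Arithmetic of the root lattice -/

theorem α_int_ext {a b c d : ℤ} (h : (a : ℂ) + b * α = c + d * α) : a = c ∧ b = d := by
  have him : α.im = Real.sqrt 7 / 2 := by simp [α]
  have hre : α.re = 1 / 2 := by simp [α]
  have h7 : Real.sqrt 7 ≠ 0 := by positivity
  have h1 := congrArg Complex.im h
  have h2 := congrArg Complex.re h
  have hbd : (b : ℝ) = d := by simpa [him, h7] using h1
  simp [hre, hbd] at h2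
  exact ⟨by exact_mod_cast h2, by exact_mod_cast hbd⟩

theorem intCast_mem_O (n : ℤ) : (n : ℂ) ∈ O := intCast_mem O n

theorem α_ne_zero : α ≠ 0 := by
  intro h0
  have h := α_sq
  rw [h0] at h
  norm_num at h

/-- `2α - 1 = √-7`. -/
theorem sqrt_neg_seven_sq : (2 * α - 1) * (2 * α - 1) = -7 := by
  linear_combination 4 * α_sq

theorem two_α_sub_one_ne : 2 * α - 1 ≠ 0 := by
  intro h
  have := sqrt_neg_seven_sq
  rw [h] at this
  norm_num at this

theorem combination_mem_Λ {a b c : ℂ} (ha : a ∈ O) (hb : b ∈ O) (hc : c ∈ O) :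
    a • e₁ + b • e₂ + c • e₃ ∈ Λ := by
  have h1 : e₁ ∈ Λ := roots_subset_Λ ⟨_, Or.inr (Or.inl rfl), 1, 1, fun i => by simp [e₁]⟩
  exact Λ.add_mem (Λ.add_mem (smul_mem_Λ ha h1) (smul_mem_Λ hb (roots_subset_Λ root₂)))
    (smul_mem_Λ hc (roots_subset_Λ root₃))

theorem combination_eq (a b c : ℂ) :
    a • e₁ + b • e₂ + c • e₃ = ![c, a * α + c, a * α + b * 2 + c * (1 - α)] := by
  ext i
  fin_cases i <;> simp [e₁, e₂, e₃, conj_α]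

/-- The roots `e₁, e₂, e₃` generate `Λ` over `O`. -/
theorem exists_combination {z : V} (hz : z ∈ Λ) :
    ∃ a ∈ O, ∃ b ∈ O, ∃ c ∈ O, z = a • e₁ + b • e₂ + c • e₃ := by
  obtain ⟨h1, h2, u, hu, h3⟩ := hz
  obtain ⟨v, hv, hv'⟩ := h2 1 0
  obtain ⟨w, hw, hw'⟩ := h2 2 1
  rw [conj_α] at h3
  refine ⟨v, hv, u + w - α * α * v - α * z 0, ?_, z 0, h1 0, ?_⟩
  · have := α_mem
    have := h1 0
    exact O.sub_mem (O.sub_mem (O.add_mem hu hw) (by aesop)) (by aesop)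
  · rw [combination_eq]
    have h := α_sq
    ext i
    fin_cases i
    · rfl
    · simp; linear_combination hv'
    · simp only [Matrix.cons_val, Fin.reduceFinMk]
      grind

theorem mk_eq_zero_iff (z : V) : (z : J) = 0 ↔ z ∈ Λ := QuotientAddGroup.eq_zero_iff z

theorem mk_eq_mk_iff (z w : V) : (z : J) = w ↔ z - w ∈ Λ := by
  rw [← sub_eq_zero, ← mk_eq_zero_iff]; rfl

/-! ### The matrices of `g₇`, `h₃` and `ρ₁` -/

theorem mat_negOne : mat negOne = -1 := rfl

theorem mat_ρ₁ : mat (ρ₁ : G336) = !![-1, 0, 0; 0, 0, -1; 0, -1, 0] := by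
  change mat (negOne * r₁) = _
  rw [mat_mul, mat_negOne, mat_r₁]
  ext i j
  fin_cases i <;> fin_cases j <;> simp

theorem mat_ρ₂ : mat (ρ₂ : G336) = !![-1, 0, 0; 0, -1, 0; 0, 0, 1] := by
  change mat (negOne * r₂) = _
  rw [mat_mul, mat_negOne, mat_r₂]
  ext i j
  fin_cases i <;> fin_cases j <;> simp

theorem mat_ρ₃ : mat (ρ₃ : G336) =
    !![-1 / 2, 1 / 2, α / 2; 1 / 2, -1 / 2, α / 2; (1 - α) / 2, (1 - α) / 2, 0] := by
  change mat (negOne * r₃) = _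
  rw [mat_mul, mat_negOne, mat_r₃, conj_α]
  ext i j
  fin_cases i <;> fin_cases j <;> simp <;> ring

theorem mat_g₇ : mat (g₇ : G336) =
    !![-1 / 2, 1 / 2, α / 2; (α - 1) / 2, (α - 1) / 2, 0; 1 / 2, -1 / 2, α / 2] := by
  change mat ((ρ₁ : G336) * ρ₂ * ρ₃) = _
  rw [mat_mul, mat_mul, mat_ρ₁, mat_ρ₂, mat_ρ₃]
  ext i j
  fin_cases i <;> fin_cases j <;> simp [Matrix.mul_apply, Fin.sum_univ_three] <;> ring

theorem mat_h₃ : mat (h₃ : G336) =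
    !![1 / 2, -α / 2, 1 / 2; (α - 1) / 2, 0, (1 - α) / 2; -1 / 2, -α / 2, -1 / 2] := by
  change mat ((ρ₁ : G336) * ρ₃ * ρ₁ * ρ₂) = _
  rw [mat_mul, mat_mul, mat_mul, mat_ρ₁, mat_ρ₂, mat_ρ₃]
  ext i j
  fin_cases i <;> fin_cases j <;> simp [Matrix.mul_apply, Fin.sum_univ_three] <;> ring

theorem mat_injective : Function.Injective mat :=
  fun _ _ h => Subtype.ext (Subtype.ext h)

theorem h₃_mul_g₇ : h₃ * g₇ * h₃⁻¹ = g₇ ^ 2 := by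
  rw [mul_inv_eq_iff_eq_mul, pow_two]
  refine Subtype.ext (mat_injective ?_)
  change mat ((h₃ : G336) * g₇) = mat ((g₇ : G336) * g₇ * h₃)
  rw [mat_mul, mat_mul, mat_mul, mat_g₇, mat_h₃]
  have h := α_sq
  ext i j
  fin_cases i <;> fin_cases j <;> simp [Matrix.mul_apply, Fin.sum_univ_three] <;> grind

theorem h₃_pow_three : h₃ ^ 3 = 1 := by
  rw [pow_succ, pow_two]
  refine Subtype.ext (mat_injective ?_)
  change mat ((h₃ : G336) * h₃ * h₃) = 1
  rw [mat_mul, mat_mul, mat_h₃]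
  have h := α_sq
  ext i j
  fin_cases i <;> fin_cases j <;> simp [Matrix.mul_apply, Fin.sum_univ_three] <;> grind

theorem negOne_mul_self : negOne * negOne = 1 :=
  mat_injective (by rw [mat_mul, mat_negOne]; simp; rfl)

theorem negOne_mul (g : G336) : negOne * g = g * negOne :=
  mat_injective (by rw [mat_mul, mat_mul, mat_negOne]; simp)

theorem g₇_eq : (g₇ : G336) = negOne * (r₁ * r₂ * r₃) := by
  refine mat_injective ?_
  rw [mat_g₇, mat_mul, mat_negOne, mat_r₁r₂r₃, conj_α]
  ext i j
  fin_cases i <;> fin_cases j <;> simp <;> ring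

theorem g₇_pow_seven : g₇ ^ 7 = 1 := by
  refine Subtype.ext ?_
  change (g₇ : G336) ^ 7 = 1
  rw [g₇_eq, (show Commute negOne (r₁ * r₂ * r₃) from negOne_mul _).mul_pow]
  refine mat_injective ?_
  rw [mat_mul, mat_pow_seven]
  have : negOne ^ 7 = negOne := by
    rw [pow_succ, show 6 = 2 * 3 from rfl, pow_mul, pow_two, negOne_mul_self]; simp
  rw [this, mat_negOne]
  simp
  rfl

instance : Fact (Nat.Prime 7) := ⟨by norm_num⟩

theorem orderOf_g₇ : orderOf g₇ = 7 := by
  refine orderOf_eq_prime g₇_pow_seven fun h => ?_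
  have h1 := congrFun (congrFun (mat_g₇.symm.trans (congrArg (fun g : H168 => mat g) h)) 0) 2
  have : mat ((1 : H168) : G336) = 1 := rfl
  rw [this] at h1
  exact α_ne_zero (by simpa using h1)

/-! ### The fixed points of `g₇` -/

theorem g₇_mulVec (a b c : ℂ) : mat (g₇ : G336) *ᵥ (a • e₁ + b • e₂ + c • e₃) =
    (-a - b + α * c) • e₁ + (-a + (α - 1) * b + c) • e₂ + ((α - 1) * a + α * b + c) • e₃ := by
  rw [mat_g₇, combination_eq, combination_eq]
  have h := α_sq
  ext i
  fin_cases i <;> simp [Matrix.mulVec, dotProduct, Fin.sum_univ_three] <;> grind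

/-- The representative of `η₁` is `(e₁ + e₂ - e₃) / √-7`. -/
theorem η_eq (k : ℕ) :
    η k = k •
      (((2 * α - 1)⁻¹ • e₁ + (2 * α - 1)⁻¹ • e₂ + (-(2 * α - 1)⁻¹) • e₃ : V) : J) := by
  have h : (2 * α - 1)⁻¹ = -(2 * α - 1) / 7 := by
    refine inv_eq_of_mul_eq_one_right ?_
    linear_combination (-1 / 7) * sqrt_neg_seven_sq
  rw [h, ← QuotientAddGroup.mk_nsmul]
  refine congrArg (QuotientAddGroup.mk : V → J) ?_
  rw [conj_α]
  ext i
  simp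
  ring

theorem combination_mem_iff {a b c : ℂ} :
    a • e₁ + b • e₂ + c • e₃ ∈ Λ ↔ a ∈ O ∧ b ∈ O ∧ c ∈ O := by
  refine ⟨fun h => ?_, fun h => combination_mem_Λ h.1 h.2.1 h.2.2⟩
  obtain ⟨a', ha, b', hb, c', hc, h⟩ := exists_combination h
  rw [combination_eq, combination_eq] at h
  have h0 := congrFun h 0
  have h1 := congrFun h 1
  have h2 := congrFun h 2
  simp only [Matrix.cons_val] at h0 h1 h2
  have hα := α_ne_zero
  subst h0
  have haa : a = a' := mul_right_cancel₀ hα (by linear_combination h1)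
  subst haa
  have hbb : b = b' := mul_right_cancel₀ two_ne_zero (by linear_combination h2)
  subst hbb
  exact ⟨ha, hb, hc⟩

theorem exists_coords (z : V) : ∃ a b c : ℂ, z = a • e₁ + b • e₂ + c • e₃ := by
  have hα := α_ne_zero
  refine ⟨(z 1 - z 0) / α, (z 2 - (z 1 - z 0) - z 0 * (1 - α)) / 2, z 0, ?_⟩
  rw [combination_eq]
  ext i
  fin_cases i <;> simp [hα]
  ring

theorem zsmul_combination (m : ℤ) (a b c : ℂ) :
    m • ((a • e₁ + b • e₂ + c • e₃ : V) : J) =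
      (((m * a) • e₁ + (m * b) • e₂ + (m * c) • e₃ : V) : J) := by
  rw [← QuotientAddGroup.mk_zsmul]
  refine congrArg _ ?_
  ext i
  simp
  ring

theorem η_one_eq :
    η 1 = (((2 * α - 1)⁻¹ • e₁ + (2 * α - 1)⁻¹ • e₂ + (-(2 * α - 1)⁻¹) • e₃ : V) : J) := by
  rw [η_eq, one_smul]

/-- Divisibility by `√-7` in `O`: the residue field is `𝔽₇`, where `2α - 1 = 0` means that `α`
becomes `4`. -/
theorem div_mem_O_iff (m n : ℤ) : (m + n * α) * (2 * α - 1)⁻¹ ∈ O ↔ (7 : ℤ) ∣ m + 4 * n := by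
  have hs := two_α_sub_one_ne
  have h := α_sq
  constructor
  · rintro ⟨a, b, hab⟩
    rw [mul_inv_eq_iff_eq_mul₀ hs] at hab
    have : (m : ℂ) + n * α = ((-a - 4 * b : ℤ) : ℂ) + ((2 * a + b : ℤ) : ℂ) * α := by
      push_cast
      linear_combination hab + 2 * b * h
    obtain ⟨h1, h2⟩ := α_int_ext this
    omega
  · rintro ⟨l, hl⟩
    obtain rfl : m = 7 * l - 4 * n := by omega
    refine ⟨l, n - 2 * l, ?_⟩
    rw [mul_inv_eq_iff_eq_mul₀ hs]
    push_cast
    linear_combination (-2 * n + 4 * l) * h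

theorem zsmul_η_one_eq_zero (m : ℤ) : m • η 1 = 0 ↔ (7 : ℤ) ∣ m := by
  have h := div_mem_O_iff m 0
  simp only [Int.cast_zero, zero_mul, add_zero, mul_zero] at h
  rw [η_one_eq, zsmul_combination, mk_eq_zero_iff, combination_mem_iff, mul_neg, neg_mem_iff, h]
  simp

theorem combination_sub (a b c a' b' c' : ℂ) :
    a • e₁ + b • e₂ + c • e₃ - (a' • e₁ + b' • e₂ + c' • e₃) =
      (a - a') • e₁ + (b - b') • e₂ + (c - c') • e₃ := by
  module

theorem H_smul_mk (h : H168) (z : V) : h • (z : J) = ((mat (h : G336) *ᵥ z : V) : J) := rfl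

theorem h₃_mulVec (a b c : ℂ) : mat (h₃ : G336) *ᵥ (a • e₁ + b • e₂ + c • e₃) =
    (-b + α * c) • e₁ + ((α - 1) * b + c) • e₂ + (a + b + (1 - α) * c) • e₃ := by
  rw [mat_h₃, combination_eq, combination_eq]
  have h := α_sq
  ext i
  fin_cases i <;> simp [Matrix.mulVec, dotProduct, Fin.sum_univ_three] <;> grind

theorem ρ₁_mulVec (a b c : ℂ) : mat (ρ₁ : G336) *ᵥ (a • e₁ + b • e₂ + c • e₃) =
    (-a + (α - 1) * b + c) • e₁ + (b - α * c) • e₂ + (-c) • e₃ := by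
  rw [mat_ρ₁, combination_eq, combination_eq]
  have h := α_sq
  ext i
  fin_cases i <;> simp [Matrix.mulVec, dotProduct, Fin.sum_univ_three] <;> grind

theorem g₇_smul_η_one : g₇ • η 1 = η 1 := by
  rw [η_one_eq, H_smul_mk, g₇_mulVec, mk_eq_mk_iff, combination_sub, combination_mem_iff]
  have h := α_sq
  have hs := two_α_sub_one_ne
  refine ⟨⟨-1, 1, ?_⟩, ⟨0, 1, ?_⟩, ⟨1, 0, ?_⟩⟩ <;> field_simp <;> push_cast <;> grind

theorem h₃_smul_η_one : h₃ • η 1 = 2 • η 1 := by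
  have h2 : 2 • η 1 = (2 : ℤ) • η 1 := (natCast_zsmul _ 2).symm
  rw [h2, η_one_eq, zsmul_combination, H_smul_mk, h₃_mulVec, mk_eq_mk_iff, combination_sub,
    combination_mem_iff]
  have h := α_sq
  have hs := two_α_sub_one_ne
  refine ⟨⟨-1, 1, ?_⟩, ⟨0, 1, ?_⟩, ⟨1, -1, ?_⟩⟩ <;> field_simp <;> push_cast <;> grind

theorem ρ₁_smul_η_one_ne (m : ℤ) : ρ₁ • η 1 ≠ m • η 1 := by
  intro h
  rw [η_one_eq, zsmul_combination, H_smul_mk, ρ₁_mulVec, mk_eq_mk_iff, combination_sub,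
    combination_mem_iff] at h
  obtain ⟨-, h2, h3⟩ := h
  have h2' := (div_mem_O_iff (1 - m) 1).1 (by convert h2 using 1; push_cast; ring)
  have h3' := (div_mem_O_iff (1 + m) 0).1 (by convert h3 using 1; push_cast; ring)
  omega

/-- The fixed points of `g₇` are the multiples of `η₁`: modulo `√-7`, the matrix of
`√-7 (g₇ - 1)⁻¹` in the basis `e₁, e₂, e₃` is the product of the column `(1, 1, -1)` and the row
`(3, 2, 5)`. -/
theorem exists_zsmul_η_of_g₇_smul {x : J} (hx : g₇ • x = x) : ∃ m : ℤ, x = m • η 1 := by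
  induction x using QuotientAddGroup.induction_on with
  | H z =>
    obtain ⟨a, b, c, rfl⟩ := exists_coords z
    rw [H_smul_mk, g₇_mulVec, mk_eq_mk_iff, combination_sub, combination_mem_iff] at hx
    obtain ⟨⟨p, p', hp⟩, ⟨q, q', hq⟩, ⟨r, r', hr⟩⟩ := hx
    refine ⟨3 * p + 2 * q + 5 * r + 4 * (3 * p' + 2 * q' + 5 * r'), ?_⟩
    rw [η_one_eq, zsmul_combination, mk_eq_mk_iff, combination_sub, combination_mem_iff]
    have h := α_sq
    have hs := two_α_sub_one_ne
    have hα := α_mem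
    have mul_mem : ∀ {x y : ℂ}, x ∈ O → y ∈ O → x * y ∈ O := O.mul_mem
    have hP : (p : ℂ) + p' * α ∈ O := ⟨p, p', rfl⟩
    have hQ : (q : ℂ) + q' * α ∈ O := ⟨q, q', rfl⟩
    have hR : (r : ℂ) + r' * α ∈ O := ⟨r, r', rfl⟩
    have hy : ((3 * p' + 2 * q' + 5 * r' : ℤ) : ℂ) * α ∈ O := O.mul_mem (intCast_mem_O _) hα
    have h1 : α - 1 ∈ O := O.sub_mem hα O.one_mem
    have h2 : 1 - α ∈ O := O.sub_mem O.one_mem hα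
    refine ⟨?_, ?_, ?_⟩
    · convert O.add_mem hy (O.add_mem (O.add_mem (O.mul_mem h1 hP) (O.mul_mem hα hQ))
        (O.mul_mem hα hR)) using 1
      field_simp
      push_cast
      grind
    · convert O.add_mem hy (O.add_mem (O.mul_mem hα hP) (O.mul_mem h1 hR)) using 1
      field_simp
      push_cast
      grind
    · convert O.add_mem (O.neg_mem hy) (O.sub_mem (O.add_mem (O.mul_mem h2 hP) (O.mul_mem h2 hQ))
        (O.mul_mem (O.add_mem hα hα) hR)) using 1
      field_simp
      push_cast
      grind

/-! ### The order of the groups -/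

theorem star_mat_mul (g : G336) : (mat g)ᴴ * mat g = 1 :=
  Matrix.mem_unitaryGroup_iff'.1 (g : Matrix.unitaryGroup (Fin 3) ℂ).2

theorem herm_mulVec (g : G336) (x y : V) : herm (mat g *ᵥ x) (mat g *ᵥ y) = herm x y := by
  have h : ∀ u v : V, herm u v = (1 / 2) * (star u ⬝ᵥ v) := fun u v => rfl
  rw [h, h, Matrix.star_mulVec, Matrix.dotProduct_mulVec, Matrix.vecMul_vecMul, star_mat_mul,
    Matrix.vecMul_one]

/-- Integer coordinates of vectors of `O³`: a pair `(a, b)` stands for `a + bα`. -/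
abbrev Code : Type := (ℤ × ℤ) × (ℤ × ℤ) × (ℤ × ℤ)

/-- The element `a + bα` of `O`. -/
noncomputable def decode (p : ℤ × ℤ) : ℂ := p.1 + p.2 * α

/-- The vector of `O³` with the given integer coordinates. -/
noncomputable def Code.vec (u : Code) : V := ![decode u.1, decode u.2.1, decode u.2.2]

/-- The norm `|a + bα|²`. -/
def codeNorm (p : ℤ × ℤ) : ℤ := p.1 * p.1 + p.1 * p.2 + 2 * (p.2 * p.2)

/-- The coordinates of the elements of `O` of norm at most 4 lie in this box. -/
noncomputable def smallCodes : Finset (ℤ × ℤ) := Finset.Icc (-2) 2 ×ˢ Finset.Icc (-1) 1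

/-- The vectors `z ∈ Λ` with `(z, z) = 2`. The congruences modulo `α` and `ᾱ` are parity
conditions, since both primes have residue field `𝔽₂`, where `α` becomes `0` and `1`
respectively. -/
noncomputable def shortCodes : Finset Code :=
  (smallCodes ×ˢ smallCodes ×ˢ smallCodes).filter fun u =>
    codeNorm u.1 + codeNorm u.2.1 + codeNorm u.2.2 = 4 ∧
      (u.1.1 - u.2.1.1) % 2 = 0 ∧ (u.1.1 - u.2.2.1) % 2 = 0 ∧
      (u.1.1 + u.1.2 + u.2.1.1 + u.2.1.2 + u.2.2.1 + u.2.2.2) % 2 = 0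

theorem card_shortCodes : shortCodes.card ≤ 42 := by decide +kernel

/-- The two integer coordinates of `x̄y`, for `x, y ∈ O`. -/
def codeMul (p q : ℤ × ℤ) : ℤ × ℤ :=
  (p.1 * q.1 + p.2 * q.1 + 2 * (p.2 * q.2), p.1 * q.2 - p.2 * q.1)

/-- The pairs of vectors of `Λ` that have the same products with `e₂` and with each other as
`e₁` and `e₃`. -/
noncomputable def frameCodes : Finset (Code × Code) :=
  (shortCodes ×ˢ shortCodes).filter fun p =>
    p.1.2.2 = (0, 1) ∧ p.2.2.2 = (1, -1) ∧
      codeMul p.1.1 p.2.1 + codeMul p.1.2.1 p.2.2.1 + codeMul p.1.2.2 p.2.2.2 = (0, -2)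

theorem card_frameCodes : frameCodes.card ≤ 8 := by decide +kernel

theorem decode_injective : Function.Injective decode := fun _ _ h =>
  Prod.ext (α_int_ext h).1 (α_int_ext h).2

theorem conj_decode_mul (p q : ℤ × ℤ) : conj (decode p) * decode q = decode (codeMul p q) := by
  simp only [decode, codeMul, map_add, map_mul, map_intCast, conj_α]
  push_cast
  linear_combination (-(p.2 : ℂ) * q.2) * α_sq

theorem herm_vec (u v : Code) : herm u.vec v.vec = (1 / 2) *
    decode (codeMul u.1 v.1 + codeMul u.2.1 v.2.1 + codeMul u.2.2 v.2.2) := by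
  have h : ∀ p q : ℤ × ℤ, decode (p + q) = decode p + decode q := by
    intro p q; simp [decode]; ring
  simp only [h, ← conj_decode_mul]
  simp [herm, Fin.sum_univ_three, Code.vec]

theorem mem_smallCodes {p : ℤ × ℤ} (h : codeNorm p ≤ 4) : p ∈ smallCodes := by
  obtain ⟨a, b⟩ := p
  simp only [codeNorm] at h
  simp only [smallCodes, Finset.mem_product, Finset.mem_Icc]
  refine ⟨⟨?_, ?_⟩, ?_, ?_⟩ <;> by_contra! hc <;>
    nlinarith [sq_nonneg (2 * a + b), sq_nonneg (a + 4 * b)]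

theorem codeNorm_nonneg (p : ℤ × ℤ) : 0 ≤ codeNorm p := by
  obtain ⟨a, b⟩ := p
  simp only [codeNorm]
  nlinarith [sq_nonneg (2 * a + b), sq_nonneg b]

theorem exists_shortCode {z : V} (hz : z ∈ Λ) (h : herm z z = 2) :
    ∃ u ∈ shortCodes, u.vec = z := by
  obtain ⟨h1, h2, w, ⟨c, d, rfl⟩, h3⟩ := hz
  have hd : ∀ i, ∃ p : ℤ × ℤ, z i = decode p := fun i => by
    obtain ⟨a, b, hab⟩ := h1 i
    exact ⟨(a, b), hab⟩
  choose p hp using hd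
  have hvec : Code.vec (p 0, p 1, p 2) = z := by
    ext i
    fin_cases i <;> simp [Code.vec, hp]
  have hmod : ∀ i j, ((p i).1 - (p j).1) % 2 = 0 := by
    intro i j
    obtain ⟨x, ⟨a, b, rfl⟩, hx⟩ := h2 i j
    rw [hp, hp] at hx
    have := (α_int_ext (a := (p i).1 - (p j).1) (b := (p i).2 - (p j).2) (c := -2 * b)
      (d := a + b) (by
        simp only [decode] at hx
        push_cast
        linear_combination hx + b * α_sq)).1
    omega
  refine ⟨(p 0, p 1, p 2), ?_, hvec⟩
  have hn : codeNorm (p 0) + codeNorm (p 1) + codeNorm (p 2) = 4 := by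
    rw [← hvec, herm_vec] at h
    have := (α_int_ext (a := codeNorm (p 0) + codeNorm (p 1) + codeNorm (p 2)) (b := 0)
      (c := 4) (d := 0) (by
        simp only [decode, codeMul, Prod.fst_add, Prod.snd_add] at h
        simp only [codeNorm]
        push_cast at h ⊢
        linear_combination 2 * h)).1
    exact this
  have n0 := codeNorm_nonneg (p 0)
  have n1 := codeNorm_nonneg (p 1)
  have n2 := codeNorm_nonneg (p 2)
  refine Finset.mem_filter.2 ⟨Finset.mem_product.2 ⟨mem_smallCodes (by dsimp only; omega),
    Finset.mem_product.2 ⟨mem_smallCodes (by dsimp only; omega),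
      mem_smallCodes (by dsimp only; omega)⟩⟩, hn, hmod 0 1, hmod 0 2, ?_⟩
  rw [hp, hp, hp, conj_α] at h3
  have := α_int_ext (a := (p 0).1 + (p 1).1 + (p 2).1) (b := (p 0).2 + (p 1).2 + (p 2).2)
    (c := c + 2 * d) (d := -c) (by
      simp only [decode] at h3
      push_cast
      linear_combination h3 - d * α_sq)
  dsimp only
  omega

theorem e₁_mem : e₁ ∈ roots := ⟨_, Or.inr (Or.inl rfl), 1, 1, fun i => by simp [e₁]⟩

theorem e₂_mem : e₂ ∈ roots := root₂

theorem e₃_mem : e₃ ∈ roots := root₃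

theorem exists_shortCode_mulVec (g : G336) {e : V} (he : e ∈ roots) :
    ∃ u ∈ shortCodes, u.vec = mat g *ᵥ e :=
  exists_shortCode (mulVec_mem_Λ g (roots_subset_Λ he)) (by rw [herm_mulVec, herm_self he])

theorem eq_of_mulVec_eq {g h : G336} (h1 : mat g *ᵥ e₁ = mat h *ᵥ e₁)
    (h2 : mat g *ᵥ e₂ = mat h *ᵥ e₂) (h3 : mat g *ᵥ e₃ = mat h *ᵥ e₃) : g = h := by
  refine mat_injective (Matrix.mulVec_injective (funext fun z => ?_))
  obtain ⟨a, b, c, rfl⟩ := exists_coords z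
  simp only [Matrix.mulVec_add, Matrix.mulVec_smul, h1, h2, h3]

theorem mat_one : mat 1 = 1 := rfl

/-- An element of `G` is determined by the images of `e₁, e₂, e₃`. There are at most 42 possible
images of `e₂`, and at most 8 ways of moving `e₁` and `e₃` when `e₂` is fixed. -/
theorem finite_G336_and_card_le : Finite G336 ∧ Nat.card G336 ≤ 336 := by
  choose c₁ hc₁ hc₁' using fun g => exists_shortCode_mulVec g e₁_mem
  choose c₂ hc₂ hc₂' using fun g => exists_shortCode_mulVec g e₂_mem
  choose c₃ hc₃ hc₃' using fun g => exists_shortCode_mulVec g e₃_mem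
  have hfin : Finite G336 := by
    refine Finite.of_injective (β := shortCodes × shortCodes × shortCodes)
      (fun g => (⟨c₁ g, hc₁ g⟩, ⟨c₂ g, hc₂ g⟩, ⟨c₃ g, hc₃ g⟩)) fun g h hgh => ?_
    simp only [Prod.mk.injEq, Subtype.mk.injEq] at hgh
    obtain ⟨h1, h2, h3⟩ := hgh
    exact eq_of_mulVec_eq (by rw [← hc₁', ← hc₁', h1]) (by rw [← hc₂', ← hc₂', h2])
      (by rw [← hc₃', ← hc₃', h3])
  refine ⟨hfin, ?_⟩
  classical
  have := Fintype.ofFinite G336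
  rw [Nat.card_eq_fintype_card, ← Finset.card_univ]
  have key : ∀ a ∈ Finset.univ.image c₂, (Finset.univ.filter fun g => c₂ g = a).card ≤ 8 := by
    intro a ha
    obtain ⟨g₀, -, rfl⟩ := Finset.mem_image.1 ha
    refine le_trans (Finset.card_le_card_of_injOn (t := frameCodes)
      (fun g => (c₁ (g₀⁻¹ * g), c₃ (g₀⁻¹ * g))) ?_ ?_) card_frameCodes
    · intro g hg
      have hg : c₂ g = c₂ g₀ := (Finset.mem_filter.1 hg).2
      have hfix : mat (g₀⁻¹ * g) *ᵥ e₂ = e₂ := by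
        rw [mat_mul, ← Matrix.mulVec_mulVec, ← hc₂', hg, hc₂', Matrix.mulVec_mulVec, ← mat_mul,
          inv_mul_cancel, mat_one, Matrix.one_mulVec]
      have hcoord : ∀ z : V, (mat (g₀⁻¹ * g) *ᵥ z) 2 = z 2 := by
        intro z
        have := herm_mulVec (g₀⁻¹ * g) e₂ z
        rw [hfix] at this
        simpa [herm, e₂, Fin.sum_univ_three, Complex.conj_ofNat] using this
      rw [Finset.mem_coe, frameCodes, Finset.mem_filter, Finset.mem_product]
      refine ⟨⟨hc₁ _, hc₃ _⟩, ?_, ?_, ?_⟩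
      · refine decode_injective ?_
        change (c₁ (g₀⁻¹ * g)).vec 2 = _
        rw [hc₁', hcoord]
        simp [e₁, decode]
      · refine decode_injective ?_
        change (c₃ (g₀⁻¹ * g)).vec 2 = _
        rw [hc₃', hcoord]
        simp [e₃, decode, conj_α]
        ring
      · refine decode_injective ?_
        have h := herm_vec (c₁ (g₀⁻¹ * g)) (c₃ (g₀⁻¹ * g))
        rw [hc₁', hc₃', herm_mulVec] at h
        have h' : herm e₁ e₃ = -α := by
          simp only [herm, e₁, e₃, Fin.sum_univ_three, Matrix.cons_val, conj_α, map_zero]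
          linear_combination (1 / 2) * α_sq
        rw [h'] at h
        have h'' : decode (0, -2) = -2 * α := by simp [decode]
        rw [h'']
        linear_combination -2 * h
    · intro g hg h hh hgh
      simp only [Prod.mk.injEq] at hgh
      have hg : c₂ g = c₂ g₀ := (Finset.mem_filter.1 hg).2
      have hh : c₂ h = c₂ g₀ := (Finset.mem_filter.1 hh).2
      refine mul_left_cancel (a := g₀⁻¹) (eq_of_mulVec_eq ?_ ?_ ?_)
      · rw [← hc₁', ← hc₁', hgh.1]
      · rw [mat_mul, mat_mul, ← Matrix.mulVec_mulVec, ← Matrix.mulVec_mulVec, ← hc₂', ← hc₂', hg,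
          hh]
      · rw [← hc₃', ← hc₃', hgh.2]
  have h42 : (Finset.univ.image c₂).card ≤ 42 :=
    (Finset.card_le_card (Finset.image_subset_iff.2 fun g _ => hc₂ g)).trans card_shortCodes
  exact (Finset.card_le_mul_card_image _ 8 key).trans (by omega)

instance : Finite G336 := finite_G336_and_card_le.1

theorem negOne_notMem : negOne ∉ H168 := by
  intro h
  have h : detG negOne = 1 := h
  rw [det_negOne] at h
  norm_num at h

theorem card_H168_le : Nat.card H168 ≤ 168 := by
  have hinj : Function.Injective
      (Sum.elim (fun h : H168 => (h : G336)) (fun h : H168 => negOne * (h : G336))) := by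
    refine Function.Injective.sumElim Subtype.val_injective
      (fun a b h => Subtype.ext (mul_left_cancel h)) fun a b h => negOne_notMem ?_
    have : negOne = a * (b : G336)⁻¹ := by rw [h, mul_inv_cancel_right]
    rw [this]
    exact H168.mul_mem a.2 (H168.inv_mem b.2)
  have := Nat.card_le_card_of_injective _ hinj
  rw [Nat.card_sum] at this
  have := finite_G336_and_card_le.2
  omega

/-- The generators of `G` are involutions, so their determinants are square roots of 1. -/
theorem detG_sq (g : G336) : detG g ^ 2 = 1 := by
  obtain ⟨g, hg⟩ := g
  change (g : Matrix (Fin 3) (Fin 3) ℂ).det ^ 2 = 1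
  induction hg using Subgroup.closure_induction with
  | one => simp
  | mul x y _ _ hx hy => rw [Submonoid.coe_mul, Matrix.det_mul, mul_pow, hx, hy, one_mul]
  | inv x _ hx =>
    have h : (x⁻¹ : Matrix.unitaryGroup (Fin 3) ℂ).1.det * x.1.det = 1 := by
      rw [← Matrix.det_mul, ← Submonoid.coe_mul, inv_mul_cancel]
      simp
    have h2 := congrArg (· ^ 2) h
    simpa only [mul_pow, hx, mul_one, one_pow] using h2
  | mem x hx =>
    obtain ⟨e, he, h⟩ := hx
    have h1 : (x : Matrix (Fin 3) (Fin 3) ℂ) * x = 1 := by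
      refine Matrix.mulVec_injective (funext fun z => ?_)
      rw [← Matrix.mulVec_mulVec, h, h, refl_refl he, Matrix.one_mulVec]
    rw [pow_two, ← Matrix.det_mul, h1, Matrix.det_one]

/-- The determinant of an element of `G` is `±1`. -/
theorem mem_H168_or (g : G336) : g ∈ H168 ∨ negOne * g ∈ H168 := by
  rcases sq_eq_one_iff.1 (detG_sq g) with h | h
  · exact Or.inl h
  · refine Or.inr ?_
    change detG _ = 1
    rw [map_mul, det_negOne, h]
    norm_num

theorem mem_H168_of_orderOf {g : G336} (hg : orderOf g = 7) : g ∈ H168 := by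
  have h7 : detG g ^ 7 = 1 := by rw [← map_pow, ← hg, pow_orderOf_eq_one, map_one]
  change detG g = 1
  have h2 := detG_sq g
  calc detG g = (detG g ^ 2) ^ 3 * detG g := by rw [h2]; simp
    _ = 1 := by rw [← h7]; ring

/-! ### Orbits and stabilizers of the points fixed by elements of order 7 -/

theorem H_smul_zsmul (h : H168) (m : ℤ) (x : J) : h • (m • x) = m • (h • x) :=
  map_zsmul (DistribSMul.toAddMonoidHom J (h : G336)) m x

theorem H_smul_zero (h : H168) : h • (0 : J) = 0 :=
  map_zero (DistribSMul.toAddMonoidHom J (h : G336))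

theorem H_smul_nsmul (h : H168) (m : ℕ) (x : J) : h • (m • x) = m • (h • x) :=
  map_nsmul (DistribSMul.toAddMonoidHom J (h : G336)) m x

theorem smul_mem_orbit_iff {h : H168} {x y : J} :
    h • y ∈ MulAction.orbit H168 x ↔ y ∈ MulAction.orbit H168 x := by
  rw [← MulAction.orbit_eq_iff, MulAction.orbit_smul, MulAction.orbit_eq_iff]

theorem η_eq_nsmul (k : ℕ) : η k = k • η 1 := by
  rw [η_eq, η_one_eq]

theorem η_one_ne_zero : η 1 ≠ 0 := fun h => by
  have := (zsmul_η_one_eq_zero 1).1 (by rw [h]; simp)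
  omega

/-- A point `x = m η₁` with `7 ∤ m` generates the same subgroup as `η₁`. -/
theorem exists_zsmul_eq_η_one {x : J} (hx : g₇ • x = x) (h0 : x ≠ 0) : ∃ m : ℤ, m • x = η 1 := by
  obtain ⟨m, rfl⟩ := exists_zsmul_η_of_g₇_smul hx
  have hm : ¬ (7 : ℤ) ∣ m := fun h => h0 ((zsmul_η_one_eq_zero m).2 h)
  have hc : IsCoprime (7 : ℤ) m :=
    (Int.prime_iff_natAbs_prime.2 (by norm_num)).coprime_iff_not_dvd.2 hm
  obtain ⟨a, b, hab⟩ := hc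
  refine ⟨b, ?_⟩
  have h7 : a • (7 : ℤ) • η 1 = 0 := by rw [(zsmul_η_one_eq_zero 7).2 dvd_rfl, smul_zero]
  rw [← mul_smul] at h7
  calc b • m • η 1 = (a * 7 + b * m) • η 1 := by rw [add_zsmul, h7, zero_add, mul_smul]
    _ = η 1 := by rw [hab, one_smul]

theorem zsmul_eq_zero_of_g₇_smul {x : J} (hx : g₇ • x = x) (h0 : x ≠ 0) (m : ℤ) :
    m • x = 0 ↔ (7 : ℤ) ∣ m := by
  obtain ⟨k, hk⟩ := exists_zsmul_eq_η_one hx h0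
  constructor
  · intro h
    rw [← zsmul_η_one_eq_zero, ← hk, smul_comm, h, smul_zero]
  · rintro ⟨l, rfl⟩
    obtain ⟨n, rfl⟩ := exists_zsmul_η_of_g₇_smul hx
    rw [← mul_smul, zsmul_η_one_eq_zero]
    exact ⟨l * n, by ring⟩

theorem exists_nsmul_of_g₇_smul {x y : J} (hx : g₇ • x = x) (h0 : x ≠ 0) (hy : g₇ • y = y) :
    ∃ k < 7, y = k • x := by
  obtain ⟨k, hk⟩ := exists_zsmul_eq_η_one hx h0
  obtain ⟨n, rfl⟩ := exists_zsmul_η_of_g₇_smul hy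
  refine ⟨((n * k) % 7).toNat, by omega, ?_⟩
  rw [← hk, ← natCast_zsmul, Int.toNat_of_nonneg (by omega), ← mul_smul, ← sub_eq_zero, ← sub_smul,
    zsmul_eq_zero_of_g₇_smul hx h0]
  omega

theorem h₃_smul_of_g₇_smul {x : J} (hx : g₇ • x = x) : h₃ • x = 2 • x := by
  obtain ⟨n, rfl⟩ := exists_zsmul_η_of_g₇_smul hx
  rw [H_smul_zsmul, h₃_smul_η_one, ← natCast_zsmul, ← natCast_zsmul, smul_comm]

/-- The element `ρ₁` moves the nonzero fixed points of `g₇` out of the set of fixed points. It shows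
that `g₇` does not generate a normal subgroup of `H`. -/
theorem ρ₁_smul_of_g₇_smul {x : J} (hx : g₇ • x = x) (h0 : x ≠ 0) : g₇ • ρ₁ • x ≠ ρ₁ • x := by
  intro h
  obtain ⟨k, hk⟩ := exists_zsmul_eq_η_one hx h0
  obtain ⟨n, hn⟩ := exists_zsmul_η_of_g₇_smul h
  refine ρ₁_smul_η_one_ne (k * n) ?_
  rw [← hk, H_smul_zsmul, hn, mul_smul, hk]

theorem orderOf_h₃ : orderOf h₃ = 3 := by
  refine orderOf_eq_prime h₃_pow_three fun h => η_one_ne_zero ?_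
  have := h₃_smul_η_one
  rw [h, one_smul, two_smul] at this
  simpa using this

theorem orderOf_ρ₁ : orderOf ρ₁ = 2 := by
  refine orderOf_eq_prime ?_ fun h => ?_
  · refine Subtype.ext (mat_injective ?_)
    rw [pow_two]
    change mat ((ρ₁ : G336) * ρ₁) = 1
    rw [mat_mul, mat_ρ₁]
    ext i j
    fin_cases i <;> fin_cases j <;> simp [Matrix.mul_apply, Fin.sum_univ_three]
  · refine ρ₁_smul_of_g₇_smul g₇_smul_η_one η_one_ne_zero ?_
    rw [h, one_smul, g₇_smul_η_one]

theorem dvd_card_H168 : 42 ∣ Nat.card H168 := by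
  have h2 := orderOf_dvd_natCard ρ₁
  have h3 := orderOf_dvd_natCard h₃
  have h7 := orderOf_dvd_natCard g₇
  rw [orderOf_ρ₁] at h2
  rw [orderOf_h₃] at h3
  rw [orderOf_g₇] at h7
  omega


/-- The points of the `H`-orbit of `x` that are fixed by `g₇`. Their number is congruent modulo 7 to
the length of the orbit. -/
theorem ncard_orbit_modEq (x : J) : (MulAction.orbit H168 x).ncard ≡
    {y | y ∈ MulAction.orbit H168 x ∧ g₇ • y = y}.ncard [MOD 7] := by
  have hp : IsPGroup 7 (Subgroup.zpowers g₇) :=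
    IsPGroup.of_card (n := 1) (by rw [Nat.card_zpowers, orderOf_g₇, pow_one])
  have hfin : Finite (MulAction.orbit H168 x) := Set.finite_range _
  have h := hp.card_modEq_card_fixedPoints (MulAction.orbit H168 x)
  rw [Nat.card_coe_set_eq, Nat.card_coe_set_eq] at h
  have h2 : {y | y ∈ MulAction.orbit H168 x ∧ g₇ • y = y} = Subtype.val ''
      MulAction.fixedPoints (Subgroup.zpowers g₇) (MulAction.orbit H168 x) := by
    ext y
    constructor
    · rintro ⟨hy, hy'⟩
      refine ⟨⟨y, hy⟩, ?_, rfl⟩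
      rintro ⟨g, hg⟩
      refine Subtype.ext ?_
      change g • y = y
      have : Subgroup.zpowers g₇ ≤ MulAction.stabilizer H168 y := by
        rw [Subgroup.zpowers_le]; exact hy'
      exact this hg
    · rintro ⟨⟨y, hy⟩, hy', rfl⟩
      exact ⟨hy, congrArg Subtype.val (hy' ⟨g₇, Subgroup.mem_zpowers g₇⟩)⟩
  rw [h2, Set.ncard_image_of_injective _ Subtype.val_injective]
  exact h

theorem nsmul_two_mem_orbit {x y : J} (hy : g₇ • y = y) (h : y ∈ MulAction.orbit H168 x) :
    2 • y ∈ MulAction.orbit H168 x := by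
  rw [← h₃_smul_of_g₇_smul hy, smul_mem_orbit_iff]
  exact h

theorem g₇_smul_nsmul {x : J} (hx : g₇ • x = x) (k : ℕ) : g₇ • (k • x) = k • x := by
  have := H_smul_zsmul g₇ k x
  rwa [hx, natCast_zsmul] at this

/-- The orbit and the stabilizer of a nonzero fixed point `x` of `g₇`, and the order of `H`. Since
`h₃` doubles the fixed points of `g₇`, those in the orbit of `x` are stable under doubling, and
their number is 3 or 6, according to whether `-x` is in the orbit. The congruence modulo 7 and the
bound on the order of `H` leave only one possibility. -/
theorem orbit_of_g₇_smul_eq {x : J} (hx : g₇ • x = x) (h0 : x ≠ 0) :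
    (MulAction.orbit H168 x).ncard = 24 ∧ Nat.card (MulAction.stabilizer H168 x) = 7 ∧
      Nat.card H168 = 168 ∧ -x ∉ MulAction.orbit H168 x := by
  set A := MulAction.orbit H168 x with hA
  have hAfin : A.Finite := Set.finite_range _
  set B := {y | y ∈ A ∧ g₇ • y = y} with hB
  have hinj : Set.InjOn (fun k : ℕ => k • x) (Set.Iio 7) := by
    intro k hk l hl hkl
    have hkl : k • x = l • x := hkl
    rw [← natCast_zsmul, ← natCast_zsmul, ← sub_eq_zero, ← sub_smul,
      zsmul_eq_zero_of_g₇_smul hx h0] at hkl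
    simp only [Set.mem_Iio] at hk hl
    omega
  have h7 : (7 : ℕ) • x = 0 := by
    rw [← natCast_zsmul, zsmul_eq_zero_of_g₇_smul hx h0]
    exact dvd_rfl
  have hneg : -x = (6 : ℕ) • x := by
    rw [neg_eq_iff_add_eq_zero, ← h7, show (7 : ℕ) = 1 + 6 from rfl, add_smul, one_smul]
  have hdbl : ∀ k : ℕ, k • x ∈ A → (2 * k) • x ∈ A := fun k hk => by
    rw [mul_smul]
    exact nsmul_two_mem_orbit (g₇_smul_nsmul hx k) hk
  have hred : ∀ k : ℕ, (k + 7) • x = k • x := fun k => by rw [add_smul, h7, add_zero]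
  have m1 : (1 : ℕ) • x ∈ A := by rw [one_smul]; exact MulAction.mem_orbit_self x
  have m2 : (2 : ℕ) • x ∈ A := hdbl 1 m1
  have m4 : (4 : ℕ) • x ∈ A := hdbl 2 m2
  have hcount : ∀ s : Finset ℕ, (∀ k ∈ s, k < 7) → (∀ k, k < 7 → (k • x ∈ A ↔ k ∈ s)) →
      B.ncard = s.card := by
    intro s hs hs'
    have : B = (fun k : ℕ => k • x) '' s := by
      ext y
      constructor
      · rintro ⟨hy, hy'⟩
        obtain ⟨k, hk, rfl⟩ := exists_nsmul_of_g₇_smul hx h0 hy'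
        exact ⟨k, (hs' k hk).1 hy, rfl⟩
      · rintro ⟨k, hk, rfl⟩
        exact ⟨(hs' k (hs k hk)).2 hk, g₇_smul_nsmul hx k⟩
    rw [this, (hinj.mono fun k hk => hs k hk).ncard_image, Set.ncard_coe_finset]
  have n0 : (0 : ℕ) • x ∉ A := by
    rw [zero_nsmul]
    rintro ⟨h, hh⟩
    have : x = h⁻¹ • (0 : J) := by rw [← hh]; simp
    exact h0 (this.trans (H_smul_zero h⁻¹))
  have hB36 : (B.ncard = 3 ∧ -x ∉ A) ∨ B.ncard = 6 := by
    by_cases m6 : (6 : ℕ) • x ∈ A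
    · right
      have m5 := hdbl 6 m6
      rw [show 2 * 6 = 5 + 7 from rfl, hred] at m5
      have m3 := hdbl 5 m5
      rw [show 2 * 5 = 3 + 7 from rfl, hred] at m3
      refine hcount {1, 2, 3, 4, 5, 6} (by decide) fun k hk => ?_
      interval_cases k
      · exact iff_of_false n0 (by decide)
      all_goals exact iff_of_true (by assumption) (by decide)
    · left
      have m3 : (3 : ℕ) • x ∉ A := fun h => m6 (hdbl 3 h)
      have m5 : (5 : ℕ) • x ∉ A := fun h => m3 (by
        have := hdbl 5 h
        rwa [show 2 * 5 = 3 + 7 from rfl, hred] at this)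
      refine ⟨hcount {1, 2, 4} (by decide) fun k hk => ?_, by rwa [hneg]⟩
      interval_cases k
      all_goals
        first
        | exact iff_of_true (by assumption) (by decide)
        | exact iff_of_false (by assumption) (by decide)
  have hmod : A.ncard % 7 = B.ncard % 7 := ncard_orbit_modEq x
  have hBA : B.ncard < A.ncard := by
    refine Set.ncard_lt_ncard ⟨fun y hy => hy.1, fun h => ?_⟩ hAfin
    exact ρ₁_smul_of_g₇_smul hx h0 (h (MulAction.mem_orbit x ρ₁)).2
  have hprod : Nat.card (MulAction.stabilizer H168 x) * A.ncard = Nat.card H168 := by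
    rw [hA, ← MulAction.index_stabilizer, Subgroup.card_mul_index]
  have hS : 7 ∣ Nat.card (MulAction.stabilizer H168 x) := by
    rw [← orderOf_g₇, ← Nat.card_zpowers]
    refine Subgroup.card_dvd_of_le ?_
    rw [Subgroup.zpowers_le]
    exact hx
  obtain ⟨u, hu⟩ := hS
  obtain ⟨t, ht⟩ := dvd_card_H168
  -- for `|H| = 42t`, a stabilizer of order `7u` and an orbit of length `n`, this gives
  -- `un = 6t ≤ 24`, where `n ≥ 10` is congruent to 3 or 6 modulo 7
  have hle := card_H168_le
  have hpos : 0 < Nat.card H168 := Nat.card_pos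
  rw [hu, ht] at hprod
  rw [ht] at hle hpos
  have ht4 : t ≤ 4 := by omega
  have hprod' : u * A.ncard = 6 * t := by linarith
  have hu0 : 0 < u := Nat.pos_of_ne_zero (by rintro rfl; omega)
  have hA24 : A.ncard ≤ 24 := by nlinarith
  have hu2 : u ≤ 2 := by
    by_contra! hc
    have : 3 * A.ncard ≤ u * A.ncard := Nat.mul_le_mul_right _ hc
    omega
  have : A.ncard = 24 ∧ t = 4 ∧ u = 1 := by
    interval_cases u <;> omega
  refine ⟨this.1, by omega, by omega, ?_⟩
  rcases hB36 with h | h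
  · exact h.2
  · omega

theorem card_H168 : Nat.card H168 = 168 :=
  (orbit_of_g₇_smul_eq g₇_smul_η_one η_one_ne_zero).2.2.1

/-- The Sylow 7-subgroup of `H` generated by an element of order 7. -/
noncomputable def sylowOfOrder {σ : H168} (hσ : orderOf σ = 7) : Sylow 7 H168 :=
  Sylow.ofCard (Subgroup.zpowers σ) (by
    have hf : (Nat.card H168).factorization 7 = 1 := by
      rw [card_H168, show 168 = 7 * 24 from rfl,
        Nat.factorization_mul (by norm_num) (by norm_num)]
      simp [Nat.factorization_eq_zero_of_not_dvd (show ¬ 7 ∣ 24 by norm_num),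
        Nat.Prime.factorization_self (show Nat.Prime 7 by norm_num)]
    rw [hf, Nat.card_zpowers, hσ, pow_one])

open scoped Pointwise in
/-- By Sylow's theorem, the subgroups of order 7 of `H` are conjugate. -/
theorem exists_conj {σ : H168} (hσ : orderOf σ = 7) :
    ∃ c : H168, ∀ τ, τ ∈ Subgroup.zpowers σ ↔ c⁻¹ * τ * c ∈ Subgroup.zpowers g₇ := by
  obtain ⟨c, hc⟩ := MulAction.exists_smul_eq H168 (sylowOfOrder orderOf_g₇) (sylowOfOrder hσ)
  refine ⟨c, fun τ => ?_⟩
  have hQ : Subgroup.zpowers σ = MulAut.conj c • Subgroup.zpowers g₇ :=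
    (congrArg Sylow.toSubgroup hc).symm
  rw [hQ, Subgroup.mem_pointwise_smul_iff_inv_smul_mem]
  simp [MulAut.smul_def]

theorem smul_eq_of_mem_zpowers {σ τ : H168} {x : J} (h : τ ∈ Subgroup.zpowers σ) (hx : σ • x = x) :
    τ • x = x := by
  have : Subgroup.zpowers σ ≤ MulAction.stabilizer H168 x := by
    rw [Subgroup.zpowers_le]; exact hx
  exact this h

theorem smul_eq_iff_of_conj {σ c : H168}
    (hc : ∀ τ, τ ∈ Subgroup.zpowers σ ↔ c⁻¹ * τ * c ∈ Subgroup.zpowers g₇) (x : J) :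
    σ • x = x ↔ g₇ • c⁻¹ • x = c⁻¹ • x := by
  constructor
  · intro h
    have h1 : c * g₇ * c⁻¹ ∈ Subgroup.zpowers σ := by
      rw [hc]
      convert Subgroup.mem_zpowers g₇ using 1
      group
    have h2 := smul_eq_of_mem_zpowers h1 h
    rw [mul_smul, mul_smul] at h2
    exact smul_left_cancel c (h2.trans (smul_inv_smul c x).symm)
  · intro h
    have h1 := smul_eq_of_mem_zpowers ((hc σ).1 (Subgroup.mem_zpowers σ)) h
    rw [mul_smul, mul_smul, smul_inv_smul] at h1
    exact smul_left_cancel _ h1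

theorem mem_T7_iff (x : J) : x ∈ T7 ↔ x ≠ 0 ∧ ∃ σ : H168, orderOf σ = 7 ∧ σ • x = x := by
  refine and_congr_right fun _ => ⟨?_, ?_⟩
  · rintro ⟨g, hg, hx⟩
    exact ⟨⟨g, mem_H168_of_orderOf hg⟩, by rwa [Subgroup.orderOf_mk], hx⟩
  · rintro ⟨σ, hσ, hx⟩
    exact ⟨σ, by rwa [Subgroup.orderOf_coe], hx⟩

/-- Every point of `T₇` is in the orbit of a nonzero fixed point of `g₇`. -/
theorem exists_conj_of_mem_T7 {x : J} (hx : x ∈ T7) :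
    ∃ (c : H168) (y : J), y ≠ 0 ∧ g₇ • y = y ∧ x = c • y := by
  obtain ⟨h0, σ, hσ, hx⟩ := (mem_T7_iff x).1 hx
  obtain ⟨c, hc⟩ := exists_conj hσ
  refine ⟨c, c⁻¹ • x, ?_, (smul_eq_iff_of_conj hc x).1 hx, (smul_inv_smul c x).symm⟩
  intro h
  rw [inv_smul_eq_iff] at h
  exact h0 (h.trans (H_smul_zero c))

theorem smul_mem_T7 (g : G336) {x : J} (hx : x ∈ T7) : g • x ∈ T7 := by
  obtain ⟨h0, k, hk, hx⟩ := hx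
  refine ⟨(smul_ne_zero_iff_ne g).2 h0, g * k * g⁻¹, ?_, ?_⟩
  · rw [← hk]
    exact orderOf_injective (MulAut.conj g).toMonoidHom (MulAut.conj g).injective k
  · rw [mul_smul, mul_smul, inv_smul_smul, hx]

theorem η_one_mem_T7 : η 1 ∈ T7 :=
  (mem_T7_iff _).2 ⟨η_one_ne_zero, g₇, orderOf_g₇, g₇_smul_η_one⟩

theorem neg_mem_T7 {x : J} (hx : x ∈ T7) : -x ∈ T7 := by
  rw [← negOne_smul]
  exact smul_mem_T7 _ hx

theorem ncard_orbit {x : J} (hx : x ∈ T7) : (MulAction.orbit H168 x).ncard = 24 := by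
  obtain ⟨c, y, h0, hy, rfl⟩ := exists_conj_of_mem_T7 hx
  rw [MulAction.orbit_smul]
  exact (orbit_of_g₇_smul_eq hy h0).1

theorem neg_notMem_orbit {x : J} (hx : x ∈ T7) : -x ∉ MulAction.orbit H168 x := by
  obtain ⟨c, y, h0, hy, rfl⟩ := exists_conj_of_mem_T7 hx
  rw [MulAction.orbit_smul, ← smul_neg, smul_mem_orbit_iff]
  exact (orbit_of_g₇_smul_eq hy h0).2.2.2

theorem stabilizer_eq_zpowers {x : J} (hx : x ∈ T7) {σ : H168} (hσ : orderOf σ = 7)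
    (h : σ • x = x) : MulAction.stabilizer H168 x = Subgroup.zpowers σ ∧
      Nat.card (MulAction.stabilizer H168 x) = 7 := by
  have h1 : Nat.card (MulAction.stabilizer H168 x) * 24 = 168 := by
    rw [← ncard_orbit hx, ← MulAction.index_stabilizer, Subgroup.card_mul_index, card_H168]
  have h2 : Nat.card (MulAction.stabilizer H168 x) = 7 := by omega
  refine ⟨(Subgroup.eq_of_le_of_card_ge ?_ ?_).symm, h2⟩
  · rw [Subgroup.zpowers_le]; exact h
  · rw [h2, Nat.card_zpowers, hσ]

theorem seven_nsmul_of_mem_T7 {x : J} (hx : x ∈ T7) : 7 • x = 0 := by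
  obtain ⟨c, y, h0, hy, rfl⟩ := exists_conj_of_mem_T7 hx
  rw [← H_smul_nsmul, ← natCast_zsmul, (zsmul_eq_zero_of_g₇_smul hy h0 _).2 (by norm_num),
    H_smul_zero]

theorem two_nsmul_mem_orbit_of_mem_T7 {x z : J} (hx : x ∈ T7) (hz : x ∈ MulAction.orbit H168 z) :
    2 • x ∈ MulAction.orbit H168 z := by
  rw [← MulAction.orbit_eq_iff.2 hz]
  obtain ⟨c, y, h0, hy, rfl⟩ := exists_conj_of_mem_T7 hx
  rw [← H_smul_nsmul, MulAction.orbit_smul, smul_mem_orbit_iff, ← h₃_smul_of_g₇_smul hy]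
  exact MulAction.mem_orbit y h₃

theorem two_nsmul_mem_T7 {x : J} (hx : x ∈ T7) : 2 • x ∈ T7 := by
  obtain ⟨h, hh⟩ := two_nsmul_mem_orbit_of_mem_T7 hx (MulAction.mem_orbit_self x)
  rw [← hh]
  exact smul_mem_T7 h hx

theorem four_nsmul_mem_orbit {x : J} (hx : x ∈ T7) : 4 • x ∈ MulAction.orbit H168 x := by
  rw [show (4 : ℕ) = 2 * 2 from rfl, mul_smul]
  exact two_nsmul_mem_orbit_of_mem_T7 (two_nsmul_mem_T7 hx)
    (two_nsmul_mem_orbit_of_mem_T7 hx (MulAction.mem_orbit_self x))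

theorem neg_mem_orbit_neg {x y : J} (h : y ∈ MulAction.orbit H168 x) :
    -y ∈ MulAction.orbit H168 (-x) := by
  obtain ⟨g, rfl⟩ := h
  exact ⟨g, smul_neg g x⟩

theorem orbit_three_nsmul {x : J} (hx : x ∈ T7) :
    MulAction.orbit H168 (3 • x) = MulAction.orbit H168 (-x) := by
  rw [MulAction.orbit_eq_iff]
  have : (3 : ℕ) • x = -((4 : ℕ) • x) := by
    rw [eq_neg_iff_add_eq_zero, ← add_smul]
    exact seven_nsmul_of_mem_T7 hx
  rw [this]
  exact neg_mem_orbit_neg (four_nsmul_mem_orbit hx)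

theorem orbit_subset_T7 {x : J} (hx : x ∈ T7) : MulAction.orbit H168 x ⊆ T7 := by
  rintro _ ⟨h, rfl⟩
  exact smul_mem_T7 h hx

theorem T7_eq_union {x : J} (hx : x ∈ T7) :
    T7 = MulAction.orbit H168 x ∪ MulAction.orbit H168 (-x) := by
  refine Set.Subset.antisymm (fun y hy => ?_)
    (Set.union_subset (orbit_subset_T7 hx) (orbit_subset_T7 (neg_mem_T7 hx)))
  obtain ⟨c, z, hz0, hz, rfl⟩ := exists_conj_of_mem_T7 hy
  obtain ⟨d, x, hx0, hx', rfl⟩ := exists_conj_of_mem_T7 hx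
  rw [← smul_neg, MulAction.orbit_smul, MulAction.orbit_smul]
  rw [Set.mem_union, smul_mem_orbit_iff, smul_mem_orbit_iff]
  have hxT : x ∈ T7 := (mem_T7_iff x).2 ⟨hx0, g₇, orderOf_g₇, hx'⟩
  have h7 := seven_nsmul_of_mem_T7 hxT
  obtain ⟨k, hk, rfl⟩ := exists_nsmul_of_g₇_smul hx' hx0 hz
  have h2 := two_nsmul_mem_orbit_of_mem_T7 hxT (MulAction.mem_orbit_self x)
  have h4 := four_nsmul_mem_orbit hxT
  have hn : ∀ k l : ℕ, k + l = 7 → k • x = -(l • x) := fun k l hkl => by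
    rw [eq_neg_iff_add_eq_zero, ← add_smul, hkl, h7]
  interval_cases k
  · simp at hz0
  · left; rw [one_smul]; exact MulAction.mem_orbit_self x
  · exact Or.inl h2
  · right; rw [hn 3 4 rfl]; exact neg_mem_orbit_neg h4
  · exact Or.inl h4
  · right; rw [hn 5 2 rfl]; exact neg_mem_orbit_neg h2
  · right; rw [hn 6 1 rfl, one_smul]; exact MulAction.mem_orbit_self _

theorem disjoint_orbit_neg {x : J} (hx : x ∈ T7) :
    Disjoint (MulAction.orbit H168 x) (MulAction.orbit H168 (-x)) := by
  refine Set.disjoint_left.2 fun y hy hy' => neg_notMem_orbit hx ?_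
  rw [← MulAction.orbit_eq_iff.2 hy, MulAction.orbit_eq_iff.2 hy']
  exact MulAction.mem_orbit_self _

theorem ncard_T7 : T7.ncard = 48 := by
  have h := η_one_mem_T7
  rw [T7_eq_union h, Set.ncard_union_eq (disjoint_orbit_neg h) (Set.finite_range _)
    (Set.finite_range _), ncard_orbit h, ncard_orbit (neg_mem_T7 h)]

/-- An element of `G` that fixes a point of `T₇` has determinant 1, because an element of the other
coset of `H` would show that `-x` is in the `H`-orbit of `x`. -/
theorem mem_H168_of_smul {x : J} (hx : x ∈ T7) {g : G336} (hg : g • x = x) : g ∈ H168 := by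
  refine (mem_H168_or g).resolve_right fun h => neg_notMem_orbit hx ⟨⟨_, h⟩, ?_⟩
  change (negOne * g) • x = -x
  rw [mul_smul, hg, negOne_smul]

theorem orbit_G336 {x : J} (hx : x ∈ T7) : MulAction.orbit G336 x = T7 := by
  refine Set.Subset.antisymm ?_ ?_
  · rintro _ ⟨g, rfl⟩
    exact smul_mem_T7 g hx
  · rw [T7_eq_union hx]
    rintro _ (⟨h, rfl⟩ | ⟨h, rfl⟩)
    · exact ⟨h, rfl⟩
    · refine ⟨h * negOne, ?_⟩
      change (h * negOne : G336) • x = (h : G336) • (-x)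
      rw [mul_smul, negOne_smul]

theorem negOne_image_orbit {x : J} (hx : x ∈ T7) :
    (fun y : J => negOne • y) '' MulAction.orbit H168 x = T7 \ MulAction.orbit H168 x := by
  have h : (fun y : J => negOne • y) '' MulAction.orbit H168 x = MulAction.orbit H168 (-x) := by
    ext y
    simp only [negOne_smul]
    constructor
    · rintro ⟨z, hz, rfl⟩
      exact neg_mem_orbit_neg hz
    · intro hy
      exact ⟨-y, by simpa using neg_mem_orbit_neg hy, neg_neg y⟩
  rw [h, T7_eq_union hx, Set.union_sdiff_left]
  exact (disjoint_orbit_neg hx).sdiff_eq_right.symm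

/-! ### The normalizers of the subgroups of order 7 -/

theorem smul_fixed_of_mem_normalizer {n : H168}
    (hn : n ∈ Subgroup.normalizer (Subgroup.zpowers g₇ : Set H168)) {x : J} (hx : g₇ • x = x) :
    g₇ • n • x = n • x := by
  have h1 : n⁻¹ * g₇ * n ∈ Subgroup.zpowers g₇ :=
    (Subgroup.mem_normalizer_iff''.1 hn g₇).1 (Subgroup.mem_zpowers g₇)
  have h2 := smul_eq_of_mem_zpowers h1 hx
  rwa [mul_smul, mul_smul, inv_smul_eq_iff] at h2

theorem mem_G21_of_mem_normalizer {n : H168}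
    (hn : n ∈ Subgroup.normalizer (Subgroup.zpowers g₇ : Set H168)) :
    n ∈ G21 := by
  have hg : g₇ ∈ G21 := Subgroup.subset_closure (Or.inl rfl)
  have hh : h₃ ∈ G21 := Subgroup.subset_closure (Or.inr rfl)
  have hfix := smul_fixed_of_mem_normalizer hn g₇_smul_η_one
  have hstab : ∀ m : H168, m • η 1 = η 1 → m ∈ G21 := by
    intro m hm
    have : m ∈ MulAction.stabilizer H168 (η 1) := hm
    rw [(stabilizer_eq_zpowers η_one_mem_T7 orderOf_g₇ g₇_smul_η_one).1] at this
    exact (Subgroup.zpowers_le.2 hg) this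
  -- the orbit of `η₁` contains no other fixed points of `g₇` than `η₁, 2η₁, 4η₁`
  have key : ∃ a ∈ G21, n • η 1 = a • η 1 := by
    obtain ⟨k, hk, hnk⟩ := exists_nsmul_of_g₇_smul g₇_smul_η_one η_one_ne_zero hfix
    have horb : k • η 1 ∈ MulAction.orbit H168 (η 1) := hnk ▸ MulAction.mem_orbit (η 1) n
    have h7 := seven_nsmul_of_mem_T7 η_one_mem_T7
    have h2 : (2 : ℕ) • η 1 ∈ MulAction.orbit H168 (η 1) :=
      two_nsmul_mem_orbit_of_mem_T7 η_one_mem_T7 (MulAction.mem_orbit_self _)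
    have h4 := four_nsmul_mem_orbit η_one_mem_T7
    have hn : ∀ k l : ℕ, k + l = 7 → l • η 1 ∈ MulAction.orbit H168 (η 1) →
        k • η 1 ∉ MulAction.orbit H168 (η 1) := fun k l hkl hl hk => by
      have : k • η 1 = -(l • η 1) := by rw [eq_neg_iff_add_eq_zero, ← add_smul, hkl, h7]
      rw [this] at hk
      have h1 := neg_mem_orbit_neg hl
      exact Set.disjoint_left.1 (disjoint_orbit_neg η_one_mem_T7) hk h1
    rw [hnk]
    interval_cases k
    · rw [zero_nsmul, smul_eq_iff_eq_inv_smul, H_smul_zero] at hnk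
      exact absurd hnk η_one_ne_zero
    · exact ⟨1, G21.one_mem, by rw [one_smul, one_smul]⟩
    · exact ⟨h₃, hh, h₃_smul_η_one.symm⟩
    · exact absurd horb (hn 3 4 rfl h4)
    · refine ⟨h₃ * h₃, G21.mul_mem hh hh, ?_⟩
      rw [mul_smul, h₃_smul_η_one, H_smul_nsmul, h₃_smul_η_one, ← mul_smul]
      rfl
    · exact absurd horb (hn 5 2 rfl h2)
    · exact absurd horb (hn 6 1 rfl (by rw [one_smul]; exact MulAction.mem_orbit_self _))
  obtain ⟨a, ha, hna⟩ := key
  have := hstab (a⁻¹ * n) (by rw [mul_smul, hna, inv_smul_smul])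
  simpa using G21.mul_mem ha this

theorem normalizer_zpowers_g₇ :
    Subgroup.normalizer (Subgroup.zpowers g₇ : Set H168) = G21 := by
  refine le_antisymm (fun n hn => mem_G21_of_mem_normalizer hn) ?_
  rw [G21, Subgroup.closure_le]
  rintro _ (rfl | rfl)
  · exact Subgroup.le_normalizer (Subgroup.mem_zpowers g₇)
  · refine Subgroup.mem_normalizer_fintype fun n hn => ?_
    obtain ⟨k, rfl⟩ := hn
    refine ⟨2 * k, ?_⟩
    change g₇ ^ (2 * k) = h₃ * g₇ ^ k * h₃⁻¹
    rw [← conj_zpow, h₃_mul_g₇, zpow_mul]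
    rfl

theorem card_G21 : Nat.card G21 = 21 := by
  have hg : g₇ ∈ G21 := Subgroup.subset_closure (Or.inl rfl)
  have hh : h₃ ∈ G21 := Subgroup.subset_closure (Or.inr rfl)
  have h21 : 21 ∣ Nat.card G21 := by
    have h1 := Subgroup.orderOf_dvd_natCard G21 hg
    have h2 := Subgroup.orderOf_dvd_natCard G21 hh
    rw [orderOf_g₇] at h1
    rw [orderOf_h₃] at h2
    omega
  -- `G21` is the normalizer of a Sylow 7-subgroup, so its index is congruent to 1 modulo 7
  have hmod : G21.index ≡ 1 [MOD 7] := by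
    rw [← normalizer_zpowers_g₇]
    have h1 := (sylowOfOrder orderOf_g₇).card_eq_index_normalizer
    exact h1 ▸ card_sylow_modEq_one 7 H168
  have hne : G21.index ≠ 1 := by
    intro h
    rw [Subgroup.index_eq_one, ← normalizer_zpowers_g₇] at h
    exact ρ₁_smul_of_g₇_smul g₇_smul_η_one η_one_ne_zero
      (smul_fixed_of_mem_normalizer (h ▸ Subgroup.mem_top ρ₁) g₇_smul_η_one)
  have hprod := G21.card_mul_index
  rw [card_H168] at hprod
  obtain ⟨t, ht⟩ := h21
  rw [ht] at hprod ⊢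
  have hti : t * G21.index = 8 := by linarith
  have h8 : G21.index ∣ 8 := ⟨t, by rw [← hti, mul_comm]⟩
  have hle : G21.index ≤ 8 := Nat.le_of_dvd (by norm_num) h8
  have hmod' : G21.index % 7 = 1 := hmod
  have h0 : G21.index = 8 := by omega
  rw [h0] at hti
  omega

theorem normalizer_equiv {σ : H168} (hσ : orderOf σ = 7) :
    Nonempty (Subgroup.normalizer (Subgroup.zpowers σ : Set H168) ≃* G21) ∧
      ∃ τ ∈ Subgroup.normalizer (Subgroup.zpowers σ : Set H168), orderOf τ = 3 ∧
        ∀ x ∈ T7, σ • x = x → τ • x = 2 • x := by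
  obtain ⟨c, hc⟩ := exists_conj hσ
  have hN : Subgroup.normalizer (Subgroup.zpowers σ : Set H168) =
      G21.map (MulAut.conj c).toMonoidHom := by
    rw [← normalizer_zpowers_g₇]
    ext n
    rw [Subgroup.mem_map_equiv, Subgroup.mem_normalizer_iff, Subgroup.mem_normalizer_iff]
    simp only [hc, MulAut.conj_symm_apply]
    constructor
    · intro h m
      have := h (c * m * c⁻¹)
      simpa [mul_assoc] using this
    · intro h m
      have := h (c⁻¹ * m * c)
      simpa [mul_assoc] using this
  have hh : h₃ ∈ G21 := Subgroup.subset_closure (Or.inr rfl)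
  refine ⟨⟨(MulEquiv.subgroupCongr hN).trans ((MulAut.conj c).subgroupMap G21).symm⟩,
    c * h₃ * c⁻¹, ?_, ?_, fun x _ hx => ?_⟩
  · rw [hN]
    exact ⟨h₃, hh, rfl⟩
  · exact (orderOf_injective (MulAut.conj c).toMonoidHom (MulAut.conj c).injective h₃).trans
      orderOf_h₃
  · rw [mul_smul, mul_smul, h₃_smul_of_g₇_smul ((smul_eq_iff_of_conj hc x).1 hx), H_smul_nsmul,
      smul_inv_smul]

/-! ### Germs of quotient spaces -/

/-- Whether a function is holomorphic on a set depends only on its values there. -/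
def HolStructure.IsLocal {X : Type*} (S : HolStructure X) : Prop :=
  ∀ (U : Set X) (f g : X → ℂ), Set.EqOn f g U → S U f → S U g

theorem isLocal_stdHol (n : ℕ) : (stdHol n).IsLocal :=
  fun _ _ _ hfg hf => DifferentiableOn.congr hf fun _ hx => (hfg hx).symm

theorem HolStructure.IsLocal.quotient {X Y : Type*} {S : HolStructure X} (hS : S.IsLocal)
    (q : X → Y) : (S.quotient q).IsLocal :=
  fun _ _ _ hfg hf => hS _ _ _ (fun _ hx => hfg hx) hf

section Germs

variable {X Y Z : Type*} [TopologicalSpace X] [TopologicalSpace Y] [TopologicalSpace Z]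
  {S : HolStructure X} {T : HolStructure Y} {R : HolStructure Z} {p : X} {q : Y} {r : Z}

theorem GermIso.symm (hS : S.IsLocal) (h : GermIso S p T q) : GermIso T q S p := by
  obtain ⟨φ, hp, hpq, hφ⟩ := h
  refine ⟨φ.symm, ?_, ?_, fun U f hU hUs => ?_⟩
  · rw [← hpq]; exact φ.map_source hp
  · rw [← hpq]; exact φ.left_inv hp
  · have h := hφ (φ.target ∩ φ.symm ⁻¹' U) (f ∘ φ.symm) (φ.symm.isOpen_inter_preimage hU)
      Set.inter_subset_left
    have hUs : U ⊆ φ.source := hUs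
    have hset : φ.source ∩ φ ⁻¹' (φ.target ∩ φ.symm ⁻¹' U) = U := by
      ext x
      constructor
      · rintro ⟨hx, -, hx'⟩
        rwa [Set.mem_preimage, φ.left_inv hx] at hx'
      · intro hx
        exact ⟨hUs hx, φ.map_source (hUs hx), by rwa [Set.mem_preimage, φ.left_inv (hUs hx)]⟩
    rw [hset] at h
    refine Iff.trans ⟨hS _ _ _ fun x hx => ?_, hS _ _ _ fun x hx => ?_⟩ h.symm
    · exact (congrArg f (φ.left_inv (hUs hx))).symm
    · exact congrArg f (φ.left_inv (hUs hx))

theorem GermIso.trans (h : GermIso S p T q) (h' : GermIso T q R r) : GermIso S p R r := by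
  obtain ⟨φ, hp, hpq, hφ⟩ := h
  obtain ⟨ψ, hq, hqr, hψ⟩ := h'
  refine ⟨φ.trans ψ, ?_, ?_, fun U f hU hUs => ?_⟩
  · rw [OpenPartialHomeomorph.trans_source]
    exact ⟨hp, by rw [Set.mem_preimage, hpq]; exact hq⟩
  · rw [OpenPartialHomeomorph.trans_apply, hpq, hqr]
  · rw [OpenPartialHomeomorph.trans_target] at hUs
    rw [hψ U f hU (hUs.trans Set.inter_subset_left),
      hφ _ _ (ψ.isOpen_inter_preimage hU) ?_]
    · have hset : φ.source ∩ φ ⁻¹' (ψ.source ∩ ψ ⁻¹' U) =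
          (φ.trans ψ).source ∩ (φ.trans ψ) ⁻¹' U := by
        rw [OpenPartialHomeomorph.trans_source]
        ext x
        simp [and_assoc]
      rw [hset]
      rfl
    · rintro y ⟨hy, hy'⟩
      have := (hUs hy').2
      rwa [Set.mem_preimage, ψ.left_inv hy] at this

theorem IsNonsingularAt.of_germIso (hS : S.IsLocal) (h : GermIso S p T q)
    (hp : IsNonsingularAt S p) : IsNonsingularAt T q := by
  obtain ⟨n, hn⟩ := hp
  exact ⟨n, (h.symm hS).trans hn⟩

theorem IsIsolatedSingularity.of_germIso (hS : S.IsLocal) (hT : T.IsLocal) (h : GermIso S p T q)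
    (hq : IsIsolatedSingularity T q) : IsIsolatedSingularity S p := by
  refine ⟨fun hp => hq.1 (hp.of_germIso hS h), ?_⟩
  obtain ⟨φ, hp, hpq, hφ⟩ := h
  have ht : Filter.Tendsto φ (𝓝[≠] p) (𝓝[≠] q) := by
    refine tendsto_nhdsWithin_of_tendsto_nhds_of_eventually_within _ ?_ ?_
    · rw [← hpq]
      exact (φ.continuousAt hp).tendsto.mono_left nhdsWithin_le_nhds
    · filter_upwards [self_mem_nhdsWithin,
        nhdsWithin_le_nhds (φ.open_source.mem_nhds hp)] with x hx hxs hxq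
      exact hx (φ.injOn hxs hp (hxq.trans hpq.symm))
  filter_upwards [ht.eventually hq.2, nhdsWithin_le_nhds (φ.open_source.mem_nhds hp)] with x hx hxs
  exact hx.of_germIso hT (GermIso.symm hS ⟨φ, hxs, rfl, hφ⟩)

end Germs

/-- An isomorphism between germs of complex vector spaces does not decrease the dimension, by the
chain rule. -/
theorem le_of_germIso_stdHol {m n : ℕ} {a : Fin m → ℂ} {b : Fin n → ℂ}
    (h : GermIso (stdHol m) a (stdHol n) b) : m ≤ n := by
  have h' := h.symm (isLocal_stdHol m)
  obtain ⟨φ, ha, hab, hφ⟩ := h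
  have hd : DifferentiableAt ℂ φ a := by
    rw [differentiableAt_pi]
    intro i
    have h1 := (hφ φ.target (fun y => y i) φ.open_target subset_rfl).1
      (differentiable_apply i).differentiableOn
    exact h1.differentiableAt ((φ.isOpen_inter_preimage φ.open_target).mem_nhds
      ⟨ha, φ.map_source ha⟩)
  have hd' : DifferentiableAt ℂ φ.symm (φ a) := by
    rw [differentiableAt_pi]
    intro i
    have h1 := (hφ (φ.target ∩ φ.symm ⁻¹' φ.source) (fun y => φ.symm y i)
      (φ.symm.isOpen_inter_preimage φ.open_source) Set.inter_subset_left).2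
      ((differentiable_apply (𝕜 := ℂ) i).differentiableOn.congr fun x hx => by
        simp [φ.left_inv hx.1])
    exact h1.differentiableAt ((φ.symm.isOpen_inter_preimage φ.open_source).mem_nhds
      ⟨φ.map_source ha, by simpa [φ.left_inv ha] using ha⟩)
  have hcomp := hd'.hasFDerivAt.comp a hd.hasFDerivAt
  have hid : HasFDerivAt (φ.symm ∘ φ) (ContinuousLinearMap.id ℂ (Fin m → ℂ)) a :=
    (hasFDerivAt_id a).congr_of_eventuallyEq (φ.eventually_left_inverse ha)
  have huniq := hcomp.unique hid
  have hinj : Function.Injective (fderiv ℂ φ a) := fun x y hxy => by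
    have h1 := congrArg (fun L : (Fin m → ℂ) →L[ℂ] (Fin m → ℂ) => L x) huniq
    have h2 := congrArg (fun L : (Fin m → ℂ) →L[ℂ] (Fin m → ℂ) => L y) huniq
    simp only [ContinuousLinearMap.comp_apply, ContinuousLinearMap.id_apply] at h1 h2
    rw [← h1, ← h2, hxy]
  have := LinearMap.finrank_le_finrank_of_injective (f := (fderiv ℂ φ a).toLinearMap) hinj
  simpa using this

/-- The fibres of `q` are homogeneous under differentiable maps of `ℂ³` over the target. -/
def HasHomogeneousFibers {Q : Type*} (q : V → Q) : Prop :=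
  ∀ z w, q z = q w → ∃ T : V → V, Differentiable ℂ T ∧ T z = w ∧ ∀ v, q (T v) = q v

/-- A differentiable change of coordinates on `ℂ³` does not change the quotient structure. -/
theorem quotient_comp_equiv {Q : Type*} (q : V → Q) (A : V ≃ V) (hA : Differentiable ℂ A)
    (hA' : Differentiable ℂ A.symm) :
    (stdHol 3).quotient (q ∘ A) = (stdHol 3).quotient q := by
  funext U f
  refine propext ?_
  change DifferentiableOn ℂ (f ∘ (q ∘ A)) ((q ∘ A) ⁻¹' U) ↔ DifferentiableOn ℂ (f ∘ q) (q ⁻¹' U)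
  constructor
  · intro hd
    refine (hd.comp (s := q ⁻¹' U) hA'.differentiableOn fun z hz => ?_).congr fun z _ => ?_
    · simpa using hz
    · simp
  · intro hd
    exact hd.comp hA.differentiableOn fun z hz => hz

section Quotients

variable {Q Q' : Type*} [TopologicalSpace Q] [TopologicalSpace Q'] {q : V → Q} {p : V → Q'}

theorem differentiableOn_preimage_iff (hq : Continuous q) (hqh : HasHomogeneousFibers q) {B : Set V}
    (hB : IsOpen B) {U : Set Q} (hU : IsOpen U) (hUB : U ⊆ q '' B) (f : Q → ℂ) :
    DifferentiableOn ℂ (f ∘ q) (q ⁻¹' U) ↔ DifferentiableOn ℂ (f ∘ q) (B ∩ q ⁻¹' U) := by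
  refine ⟨fun h => h.mono Set.inter_subset_right, fun h w hw => ?_⟩
  obtain ⟨z, hz, hzw⟩ := hUB hw
  obtain ⟨T, hT, rfl, hTq⟩ := hqh w z hzw.symm
  have h1 : DifferentiableAt ℂ (f ∘ q) (T w) :=
    h.differentiableAt ((hB.inter (hU.preimage hq)).mem_nhds ⟨hz, by
      rw [Set.mem_preimage, hzw]; exact hw⟩)
  have h2 : f ∘ q = (f ∘ q) ∘ T := funext fun v => congrArg f (hTq v).symm
  rw [h2]
  exact (h1.comp w (hT w)).differentiableWithinAt

/-- Two quotients of `ℂ³` whose projections have the same fibres on an open set have isomorphic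
germs there. -/
theorem germIso_of_fibers (hq : Continuous q) (hqo : IsOpenMap q) (hqh : HasHomogeneousFibers q)
    (hp : Continuous p) (hpo : IsOpenMap p) (hph : HasHomogeneousFibers p) {B : Set V}
    (hB : IsOpen B) {z₀ : V} (hz₀ : z₀ ∈ B)
    (h : ∀ z ∈ B, ∀ w ∈ B, q z = q w ↔ p z = p w) :
    GermIso ((stdHol 3).quotient q) (q z₀) ((stdHol 3).quotient p) (p z₀) := by
  have hf : ∀ z ∈ B, p (Function.invFunOn q B (q z)) = p z := fun z hz =>
    (h _ (Function.invFunOn_mem ⟨z, hz, rfl⟩) _ hz).1 (Function.invFunOn_eq ⟨z, hz, rfl⟩)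
  have hg : ∀ z ∈ B, q (Function.invFunOn p B (p z)) = q z := fun z hz =>
    (h _ (Function.invFunOn_mem ⟨z, hz, rfl⟩) _ hz).2 (Function.invFunOn_eq ⟨z, hz, rfl⟩)
  let φ : OpenPartialHomeomorph Q Q' :=
    { toFun := fun y => p (Function.invFunOn q B y)
      invFun := fun y => q (Function.invFunOn p B y)
      source := q '' B
      target := p '' B
      map_source' := by
        rintro _ ⟨z, hz, rfl⟩
        exact ⟨z, hz, (hf z hz).symm⟩
      map_target' := by
        rintro _ ⟨z, hz, rfl⟩
        exact ⟨z, hz, (hg z hz).symm⟩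
      left_inv' := by
        rintro _ ⟨z, hz, rfl⟩
        rw [hf z hz, hg z hz]
      right_inv' := by
        rintro _ ⟨z, hz, rfl⟩
        rw [hg z hz, hf z hz]
      open_source := hqo B hB
      open_target := hpo B hB
      continuousOn_toFun := by
        rintro _ ⟨z, hz, rfl⟩
        refine ContinuousAt.continuousWithinAt ?_
        rw [ContinuousAt, ← hqo.map_nhds_eq hq.continuousAt, Filter.tendsto_map'_iff, hf z hz]
        refine (hp.tendsto z).congr' ?_
        filter_upwards [hB.mem_nhds hz] with w hw using (hf w hw).symm
      continuousOn_invFun := by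
        rintro _ ⟨z, hz, rfl⟩
        refine ContinuousAt.continuousWithinAt ?_
        rw [ContinuousAt, ← hpo.map_nhds_eq hp.continuousAt, Filter.tendsto_map'_iff, hg z hz]
        refine (hq.tendsto z).congr' ?_
        filter_upwards [hB.mem_nhds hz] with w hw using (hg w hw).symm }
  refine ⟨φ, ⟨z₀, hz₀, rfl⟩, hf z₀ hz₀, fun U f hU hUB => ?_⟩
  have h1 := differentiableOn_preimage_iff hp hph hB hU hUB f
  have h2 := differentiableOn_preimage_iff hq hqh hB (φ.isOpen_inter_preimage hU)
    Set.inter_subset_left (f ∘ φ)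
  refine h1.trans (Iff.trans ?_ h2.symm)
  have hset : B ∩ q ⁻¹' (φ.source ∩ φ ⁻¹' U) = B ∩ p ⁻¹' U := by
    ext z
    refine and_congr_right fun hz => ?_
    change (q z ∈ q '' B ∧ p (Function.invFunOn q B (q z)) ∈ U) ↔ p z ∈ U
    rw [hf z hz]
    exact and_iff_right ⟨z, hz, rfl⟩
  rw [hset]
  exact differentiableOn_congr fun z hz => congrArg f (hf z hz.1).symm

/-- Where the projection of a quotient of `ℂ³` is injective, the quotient is nonsingular. -/
theorem germIso_stdHol_of_injOn (hq : Continuous q) (hqo : IsOpenMap q)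
    (hqh : HasHomogeneousFibers q) {B : Set V} (hB : IsOpen B) {z₀ : V} (hz₀ : z₀ ∈ B)
    (h : Set.InjOn q B) : GermIso ((stdHol 3).quotient q) (q z₀) (stdHol 3) 0 := by
  have h1 : HasHomogeneousFibers (id ∘ Equiv.subRight z₀ : V → V) := fun z w hzw =>
    ⟨id, differentiable_id, (Equiv.subRight z₀).injective hzw, fun _ => rfl⟩
  have h2 := germIso_of_fibers hq hqo hqh (p := id ∘ Equiv.subRight z₀)
    (Homeomorph.subRight z₀).continuous (Homeomorph.subRight z₀).isOpenMap h1 hB hz₀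
    fun z hz w hw => ⟨fun e => by rw [h hz hw e], fun e => by rw [(Equiv.subRight z₀).injective e]⟩
  rw [quotient_comp_equiv id (Equiv.subRight z₀) (differentiable_id.sub_const z₀)
    (differentiable_id.add_const z₀)] at h2
  have hid : (stdHol 3).quotient id = stdHol 3 := rfl
  rw [hid] at h2
  simpa using h2

end Quotients

/-! ### The cyclic quotient singularity `(1/7)(1, 2, 4)` -/

section Cyclic

variable (d : ℕ) (ν : Fin 3 → ℤ)

/-- The projection `ℂ³ → ℂ³ / C_d`. -/
abbrev cyclicMk (z : V) : CyclicQuotient d ν := Quotient.mk (cyclicSetoid d ν) z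

/-- The action of the `k`-th power of the generator of `C_d` on `ℂ³`. -/
noncomputable def cyclicAct (k : ℤ) (z : V) : V :=
  fun i => (Complex.exp (2 * Real.pi * Complex.I / d) ^ ν i) ^ k * z i

variable {d ν}

theorem cyclicMk_eq_iff {z w : V} :
    cyclicMk d ν z = cyclicMk d ν w ↔ ∃ k, w = cyclicAct d ν k z := by
  rw [Quotient.eq]
  exact exists_congr fun k => funext_iff.symm

theorem differentiable_cyclicAct (k : ℤ) : Differentiable ℂ (cyclicAct d ν k) := by
  unfold cyclicAct
  fun_prop

theorem continuous_cyclicMk : Continuous (cyclicMk d ν) := continuous_quotient_mk'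

theorem isOpenMap_cyclicMk : IsOpenMap (cyclicMk d ν) := by
  intro U hU
  rw [← isQuotientMap_quotient_mk'.isOpen_preimage]
  have : Quotient.mk (cyclicSetoid d ν) ⁻¹' (cyclicMk d ν '' U) =
      ⋃ k : ℤ, cyclicAct d ν k ⁻¹' U := by
    ext z
    simp only [Set.mem_preimage, Set.mem_image, Set.mem_iUnion]
    constructor
    · rintro ⟨w, hw, h⟩
      obtain ⟨k, rfl⟩ := cyclicMk_eq_iff.1 h.symm
      exact ⟨k, hw⟩
    · rintro ⟨k, hk⟩
      exact ⟨_, hk, (cyclicMk_eq_iff.2 ⟨k, rfl⟩).symm⟩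
  change IsOpen (Quotient.mk (cyclicSetoid d ν) ⁻¹' (cyclicMk d ν '' U))
  rw [this]
  exact isOpen_iUnion fun k => hU.preimage (differentiable_cyclicAct k).continuous

theorem hasHomogeneousFibers_cyclicMk : HasHomogeneousFibers (cyclicMk d ν) := by
  intro z w h
  obtain ⟨k, rfl⟩ := cyclicMk_eq_iff.1 h
  exact ⟨_, differentiable_cyclicAct k, rfl, fun v => (cyclicMk_eq_iff.2 ⟨k, rfl⟩).symm⟩

theorem isLocal_cyclicHol : (cyclicHol d ν).IsLocal := (isLocal_stdHol 3).quotient _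

end Cyclic

/-- The primitive seventh root of unity `exp(2πi/7)`. -/
noncomputable def ε : ℂ := Complex.exp (2 * Real.pi * Complex.I / (7 : ℕ))

theorem isPrimitiveRoot_ε : IsPrimitiveRoot ε 7 := Complex.isPrimitiveRoot_exp 7 (by norm_num)

theorem cyclicAct_eq (k : ℤ) (z : V) : cyclicAct 7 ![1, 2, 4] k z =
    ![ε ^ k * z 0, (ε ^ k) ^ 2 * z 1, (ε ^ k) ^ 4 * z 2] := by
  have h0 : (ε ^ (2 : ℤ)) ^ k = (ε ^ k) ^ 2 := by
    rw [← zpow_mul, mul_comm, zpow_mul]; norm_cast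
  have h1 : (ε ^ (4 : ℤ)) ^ k = (ε ^ k) ^ 4 := by
    rw [← zpow_mul, mul_comm, zpow_mul]; norm_cast
  ext i
  rw [cyclicAct]
  change ((ε ^ _) ^ k) * _ = _
  fin_cases i
  · simp
  · simpa using Or.inl h0
  · simpa using Or.inl h1

theorem ε_zpow_pow_seven (k : ℤ) : (ε ^ k) ^ 7 = 1 := by
  rw [← zpow_natCast, ← zpow_mul, mul_comm, zpow_mul, zpow_natCast, isPrimitiveRoot_ε.pow_eq_one,
    one_zpow]

theorem cyclicAct_eq_self {k : ℤ} {z : V} (hz : z ≠ 0) (h : cyclicAct 7 ![1, 2, 4] k z = z) :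
    (7 : ℤ) ∣ k := by
  refine (isPrimitiveRoot_ε.zpow_eq_one_iff_dvd k).1 ?_
  rw [cyclicAct_eq] at h
  have h7 := ε_zpow_pow_seven k
  generalize ε ^ k = a at h h7
  by_contra ha
  refine hz (funext fun i => ?_)
  have h0 : a * z 0 = z 0 := congrFun h 0
  have h1 : a ^ 2 * z 1 = z 1 := congrFun h 1
  have h2 : a ^ 4 * z 2 = z 2 := congrFun h 2
  fin_cases i
  · by_contra hi
    exact ha (mul_right_cancel₀ hi (h0.trans (one_mul _).symm))
  · by_contra hi
    have e : a ^ 2 = 1 := mul_right_cancel₀ hi (h1.trans (one_mul _).symm)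
    exact ha (by linear_combination h7 - (a ^ 5 + a ^ 3 + a) * e)
  · by_contra hi
    have e : a ^ 4 = 1 := mul_right_cancel₀ hi (h2.trans (one_mul _).symm)
    exact ha (by linear_combination (a ^ 4 + 1) * e - a * h7)

theorem cyclicAct_mod (k : ℤ) : cyclicAct 7 ![1, 2, 4] k = cyclicAct 7 ![1, 2, 4] (k % 7) := by
  funext z
  rw [cyclicAct_eq, cyclicAct_eq]
  have : ε ^ k = ε ^ (k % 7) := by
    conv_lhs => rw [← Int.emod_add_mul_ediv k 7]
    have h := isPrimitiveRoot_ε.pow_eq_one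
    rw [zpow_add₀ (isPrimitiveRoot_ε.ne_zero (by norm_num)), zpow_mul]
    have h' : ε ^ (7 : ℤ) = 1 := by exact_mod_cast h
    rw [h', one_zpow, mul_one]
  rw [this]

/-- The cyclic group acts freely outside the origin, so its quotient is smooth there. -/
theorem germIso_cyclic {z : V} (hz : z ≠ 0) :
    GermIso (cyclicHol 7 ![1, 2, 4]) (cyclicMk 7 ![1, 2, 4] z) (stdHol 3) 0 := by
  have hev : ∀ᶠ x : V × V in 𝓝 z ×ˢ 𝓝 z, ∀ k ∈ Finset.Ioo (0 : ℤ) 7,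
      cyclicAct 7 ![1, 2, 4] k x.1 ≠ x.2 := by
    rw [Filter.eventually_all_finset]
    intro k hk
    rw [← nhds_prod_eq]
    have hc : ContinuousAt (fun x : V × V => cyclicAct 7 ![1, 2, 4] k x.1 - x.2) (z, z) := by
      have := (differentiable_cyclicAct (d := 7) (ν := ![1, 2, 4]) k).continuous
      fun_prop
    have hne : cyclicAct 7 ![1, 2, 4] k z - z ≠ 0 := fun h => by
      have := cyclicAct_eq_self hz (sub_eq_zero.1 h)
      have := Finset.mem_Ioo.1 hk
      omega
    filter_upwards [hc.eventually_ne hne] with x hx h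
    exact hx (sub_eq_zero.2 h)
  obtain ⟨t, ht, h⟩ := (Filter.eventually_prod_self_iff
    (r := fun x y : V => ∀ k ∈ Finset.Ioo (0 : ℤ) 7, cyclicAct 7 ![1, 2, 4] k x ≠ y)).1 hev
  obtain ⟨B, hBt, hB, hzB⟩ := mem_nhds_iff.1 ht
  refine germIso_stdHol_of_injOn continuous_cyclicMk isOpenMap_cyclicMk
    hasHomogeneousFibers_cyclicMk hB hzB fun x hx y hy hxy => ?_
  obtain ⟨k, rfl⟩ := cyclicMk_eq_iff.1 hxy
  rw [cyclicAct_mod] at hy ⊢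
  have h0 : k % 7 = 0 := by
    by_contra hk
    exact h _ (hBt hx) _ (hBt hy) (k % 7) (Finset.mem_Ioo.2 (by omega)) rfl
  rw [h0, cyclicAct_eq]
  ext i
  fin_cases i <;> simp

/-- A holomorphic function of one variable that is invariant under multiplication by a primitive
seventh root of unity is a power series in the seventh power of the variable. -/
theorem isBigO_pow_seven {E : Type*} [NormedAddCommGroup E] [NormedSpace ℂ E] {f : ℂ → E}
    (hf : AnalyticAt ℂ f 0) (h0 : f 0 = 0) (hinv : ∀ᶠ t in 𝓝 0, f (ε * t) = f t) :
    f =O[𝓝 0] fun t => t ^ 7 := by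
  by_cases hz : ∀ᶠ t in 𝓝 0, f t = 0
  · exact (Asymptotics.isBigO_zero _ _).congr' (hz.mono fun t ht => ht.symm) Filter.EventuallyEq.rfl
  · obtain ⟨m, g, hg, hg0, hfg⟩ := hf.exists_eventuallyEq_pow_smul_nonzero_iff.2 hz
    simp only [sub_zero] at hfg
    have hε : Filter.Tendsto (fun t : ℂ => ε * t) (𝓝 0) (𝓝 0) := by
      have : Continuous fun t : ℂ => ε * t := by fun_prop
      simpa using this.tendsto 0
    have heq : ∀ᶠ t in 𝓝[≠] (0 : ℂ), ε ^ m • g (ε * t) = g t := by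
      filter_upwards [nhdsWithin_le_nhds hinv, nhdsWithin_le_nhds hfg,
        nhdsWithin_le_nhds (hε.eventually hfg), self_mem_nhdsWithin] with t h1 h2 h3 ht
      rw [h2, h3, mul_pow, mul_comm, mul_smul] at h1
      exact smul_right_injective E (pow_ne_zero m ht) h1
    have hlim : Filter.Tendsto (fun t => ε ^ m • g (ε * t)) (𝓝[≠] 0) (𝓝 (ε ^ m • g 0)) :=
      ((hg.continuousAt.tendsto.comp hε).const_smul _).mono_left nhdsWithin_le_nhds
    have hlim' : Filter.Tendsto (fun t => ε ^ m • g (ε * t)) (𝓝[≠] 0) (𝓝 (g 0)) :=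
      (hg.continuousAt.tendsto.mono_left nhdsWithin_le_nhds).congr' (heq.mono fun t ht => ht.symm)
    have hm : ε ^ m = 1 := by
      have := tendsto_nhds_unique hlim hlim'
      exact smul_left_injective ℂ hg0 (by simpa using this)
    obtain ⟨l, rfl⟩ := (isPrimitiveRoot_ε.pow_eq_one_iff_dvd m).1 hm
    have hl : l ≠ 0 := by
      rintro rfl
      have := hfg.self_of_nhds
      rw [h0] at this
      simp at this
      exact hg0 this.symm
    have hO : (fun t : ℂ => t ^ (7 * l) • g t) =O[𝓝 0] fun t => t ^ 7 := by
      obtain ⟨l, rfl⟩ := Nat.exists_eq_succ_of_ne_zero hl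
      have h1 : (fun t : ℂ => t ^ (7 * l) • g t) =O[𝓝 0] fun _ => (1 : ℂ) := by
        have : ContinuousAt (fun t : ℂ => t ^ (7 * l) • g t) 0 :=
          (continuousAt_id.pow _).smul hg.continuousAt
        exact this.isBigO_one ℂ
      have h2 := (Asymptotics.isBigO_refl (fun t : ℂ => t ^ 7) (𝓝 0)).smul h1
      refine h2.congr (fun t => ?_) fun t => by simp
      rw [← mul_smul, ← pow_add, Nat.succ_eq_add_one]
      congr 2
      ring
    exact hO.congr' (hfg.mono fun t ht => ht.symm) Filter.EventuallyEq.rfl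

/-- Four invariant monomials of weight 7, where the variables have weights 1, 2, 4. -/
def invMonomial (z : V) : Fin 4 → ℂ :=
  ![z 0 * z 1 * z 2, z 0 * z 1 ^ 3, z 0 ^ 3 * z 2, z 0 ^ 3 * z 1 ^ 2]

theorem invMonomial_cyclicAct (k : ℤ) (z : V) :
    invMonomial (cyclicAct 7 ![1, 2, 4] k z) = invMonomial z := by
  have h7 := ε_zpow_pow_seven k
  rw [cyclicAct_eq]
  generalize ε ^ k = a at h7
  ext j
  fin_cases j <;> simp [invMonomial]
  · linear_combination (z 0 * z 1 * z 2) * h7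
  · linear_combination (z 0 * z 1 ^ 3) * h7
  · linear_combination (z 0 ^ 3 * z 2) * h7
  · linear_combination (z 0 ^ 3 * z 1 ^ 2) * h7

/-- The invariant monomials as functions on the quotient. -/
noncomputable def quotMonomial (j : Fin 4) : CyclicQuotient 7 ![1, 2, 4] → ℂ :=
  Quotient.lift (fun z => invMonomial z j) fun z w h => by
    obtain ⟨k, rfl⟩ := cyclicMk_eq_iff.1 (Quotient.sound h)
    exact (congrFun (invMonomial_cyclicAct k z) j).symm

/-- The curve `t ↦ (v₀t, v₁t², v₂t⁴)`, on which the cyclic group acts by multiplication of the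
parameter by seventh roots of unity. -/
def weightedCurve (v : V) (t : ℂ) : V := ![v 0 * t, v 1 * t ^ 2, v 2 * t ^ 4]

theorem differentiable_invMonomial (j : Fin 4) : Differentiable ℂ fun z => invMonomial z j := by
  fin_cases j <;> simp [invMonomial] <;> fun_prop

theorem differentiable_weightedCurve (v : V) : Differentiable ℂ (weightedCurve v) := by
  rw [differentiable_pi]
  intro i
  fin_cases i
  all_goals simp [weightedCurve]
  all_goals fun_prop

theorem cyclicMk_weightedCurve (v : V) (t : ℂ) :
    cyclicMk 7 ![1, 2, 4] (weightedCurve v (ε * t)) =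
      cyclicMk 7 ![1, 2, 4] (weightedCurve v t) := by
  refine (cyclicMk_eq_iff.2 ⟨1, ?_⟩).symm
  rw [cyclicAct_eq]
  ext i
  fin_cases i <;> simp [weightedCurve] <;> ring

theorem invMonomial_weightedCurve (v : V) (t : ℂ) (j : Fin 4) :
    invMonomial (weightedCurve v t) j = t ^ 7 * invMonomial v j := by
  fin_cases j <;> simp [weightedCurve, invMonomial] <;> ring

theorem linearIndependent_invMonomial {c : Fin 4 → ℂ}
    (h : ∀ v : V, ∑ j, c j * invMonomial v j = 0) : c = 0 := by
  have h1 := h ![1, 1, 0]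
  have h2 := h ![1, 2, 0]
  have h3 := h ![1, 0, 1]
  have h4 := h ![1, 1, 1]
  simp [Fin.sum_univ_four, invMonomial] at h1 h2 h3 h4
  have c1 : c 1 = 0 := by linear_combination (h2 - 4 * h1) / 4
  have c3 : c 3 = 0 := by linear_combination h1 - c1
  ext j
  fin_cases j
  · simp; linear_combination h4 - c1 - h3 - c3
  · exact c1
  · exact h3
  · exact c3

/-- The germ of `(1/7)(1, 2, 4)` is singular. A smooth chart would have three coordinates, since
the quotient is smooth of dimension 3 outside the origin, so some nonzero combination of the four
invariant monomials would have zero differential in the chart. Along a weighted curve, the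
coordinates of the chart are `O(t⁷)`, so this combination would be `o(t⁷)`; but it has weight 7. -/
theorem not_isNonsingularAt_cyclic :
    ¬ IsNonsingularAt (cyclicHol 7 ![1, 2, 4]) (cyclicMk 7 ![1, 2, 4] 0) := by
  rintro ⟨n, φ, hs, hφ0, hφ⟩
  set q := cyclicMk 7 ![1, 2, 4] with hq
  have hqc : Continuous q := continuous_cyclicMk
  have hW : IsOpen (q ⁻¹' φ.source) := φ.open_source.preimage hqc
  have hn : n ≤ 3 := by
    have h1 : ∀ᶠ z in 𝓝[≠] (0 : V), q z ∈ φ.source :=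
      nhdsWithin_le_nhds (hW.mem_nhds hs)
    obtain ⟨z, hz, hz0⟩ := (h1.and self_mem_nhdsWithin).exists
    have h2 : GermIso (cyclicHol 7 ![1, 2, 4]) (q z) (stdHol n) (φ (q z)) := ⟨φ, hz, rfl, hφ⟩
    exact le_of_germIso_stdHol ((h2.symm isLocal_cyclicHol).trans (germIso_cyclic hz0))
  have hF : DifferentiableOn ℂ (φ ∘ q) (q ⁻¹' φ.source) := by
    rw [differentiableOn_pi]
    intro i
    have h1 := (hφ φ.target (fun y => y i) φ.open_target subset_rfl).1
      (differentiable_apply i).differentiableOn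
    exact DifferentiableOn.mono h1 fun z hz => ⟨hz, φ.map_source hz⟩
  have hh : ∀ j, DifferentiableAt ℂ (quotMonomial j ∘ φ.symm) 0 := by
    intro j
    have h1 := (hφ φ.target (quotMonomial j ∘ φ.symm) φ.open_target subset_rfl).2
      ((differentiable_invMonomial j).differentiableOn.congr fun z hz =>
        congrArg (quotMonomial j) (φ.left_inv hz.1))
    exact DifferentiableOn.differentiableAt h1
      (φ.open_target.mem_nhds (by rw [← hφ0]; exact φ.map_source hs))
  -- the differentials of four functions of at most three variables are linearly dependent
  obtain ⟨c, hc, i₀, hi₀⟩ : ∃ c : Fin 4 → ℂ, ∑ j, c j • fderiv ℂ (quotMonomial j ∘ φ.symm) 0 = 0 ∧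
      ∃ j, c j ≠ 0 := by
    have hdep : ¬ LinearIndependent ℂ fun (j : Fin 4) (i : Fin n) =>
        fderiv ℂ (quotMonomial j ∘ φ.symm) 0 (Pi.single i 1) := fun hli => by
      have := hli.fintype_card_le_finrank
      simp at this
      omega
    obtain ⟨c, hc, hj⟩ := Fintype.not_linearIndependent_iff.1 hdep
    refine ⟨c, ?_, hj⟩
    refine ContinuousLinearMap.coe_injective (LinearMap.pi_ext' fun i => LinearMap.ext_ring ?_)
    simpa using congrFun hc i
  have hderiv : HasFDerivAt (fun w => ∑ j, c j * quotMonomial j (φ.symm w))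
      (0 : (Fin n → ℂ) →L[ℂ] ℂ) 0 := by
    rw [← hc]
    exact HasFDerivAt.fun_sum fun j _ => (hh j).hasFDerivAt.const_mul (c j)
  have hlittle : (fun w => ∑ j, c j * quotMonomial j (φ.symm w)) =o[𝓝 0]
      fun w : Fin n → ℂ => w := by
    have h1 := hderiv.isLittleO
    have h0 : φ.symm 0 = q 0 := by rw [← hφ0, φ.left_inv hs]
    have h2 : ∑ j, c j * quotMonomial j (φ.symm 0) = 0 := by
      refine Finset.sum_eq_zero fun j _ => ?_
      rw [h0]
      change c j * invMonomial 0 j = 0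
      fin_cases j <;> simp [invMonomial]
    simpa [h2] using h1
  refine hi₀ (congrFun (linearIndependent_invMonomial fun v => ?_) i₀)
  have hγ := differentiable_weightedCurve v
  have hγ0 : weightedCurve v 0 = 0 := by
    ext i
    fin_cases i <;> simp [weightedCurve]
  have hWγ : IsOpen (weightedCurve v ⁻¹' (q ⁻¹' φ.source)) := hW.preimage hγ.continuous
  have h0W : (0 : ℂ) ∈ weightedCurve v ⁻¹' (q ⁻¹' φ.source) := by
    rw [Set.mem_preimage, hγ0]
    exact hs
  have han : AnalyticAt ℂ (fun t => φ (q (weightedCurve v t))) 0 :=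
    (hF.comp hγ.differentiableOn fun t ht => ht).analyticAt (hWγ.mem_nhds h0W)
  have hval : φ (q (weightedCurve v 0)) = 0 := by rw [hγ0, hφ0]
  have hbig := isBigO_pow_seven han hval
    (Filter.Eventually.of_forall fun t => congrArg φ (cyclicMk_weightedCurve v t))
  have htend : Filter.Tendsto (fun t => φ (q (weightedCurve v t))) (𝓝 0) (𝓝 0) := by
    have := han.continuousAt.tendsto
    rwa [hval] at this
  have hsmall := (hlittle.comp_tendsto htend).trans_isBigO hbig
  have hsmall' : (fun t : ℂ => (∑ j, c j * invMonomial v j) * t ^ 7) =o[𝓝 0] fun t => t ^ 7 := by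
    refine hsmall.congr' ?_ Filter.EventuallyEq.rfl
    filter_upwards [hWγ.mem_nhds h0W] with t ht
    simp only [Function.comp_apply]
    rw [φ.left_inv ht, Finset.sum_mul]
    refine Finset.sum_congr rfl fun j _ => ?_
    change c j * invMonomial (weightedCurve v t) j = _
    rw [invMonomial_weightedCurve]
    ring
  by_contra hne
  rw [Asymptotics.isLittleO_const_mul_left_iff hne] at hsmall'
  refine Asymptotics.isLittleO_irrefl' ?_ hsmall'
  have : ∀ᶠ t in 𝓝[≠] (0 : ℂ), ‖t ^ 7‖ ≠ 0 := by
    filter_upwards [self_mem_nhdsWithin] with t ht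
    exact norm_ne_zero_iff.2 (pow_ne_zero 7 ht)
  exact this.frequently.filter_mono nhdsWithin_le_nhds

theorem isIsolatedSingularity_cyclic :
    IsIsolatedSingularity (cyclicHol 7 ![1, 2, 4]) (cyclicMk 7 ![1, 2, 4] 0) := by
  refine ⟨not_isNonsingularAt_cyclic, ?_⟩
  filter_upwards [self_mem_nhdsWithin] with x hx
  induction x using Quotient.inductionOn with
  | h z => exact ⟨3, germIso_cyclic fun h => hx (congrArg _ h)⟩

/-! ### Diagonalization of `g₇` -/

/-- The period `ε + ε² + ε⁴` is one of the roots `α - 1` and `-α` of `x² + x + 2`, and inverting `ε`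
exchanges them. So the sign of the quadratic Gauss sum is not needed: the germ of a cyclic quotient
does not depend on the choice of the generator. -/
theorem exists_gauss_period : ∃ e : ℕ, e.Coprime 7 ∧
    ε ^ e + (ε ^ e) ^ 2 + (ε ^ e) ^ 4 = α - 1 := by
  have h7 : ε ^ 7 = 1 := isPrimitiveRoot_ε.pow_eq_one
  have hsum : 1 + ε + ε ^ 2 + ε ^ 3 + ε ^ 4 + ε ^ 5 + ε ^ 6 = 0 := by
    have := isPrimitiveRoot_ε.geom_sum_eq_zero (by norm_num)
    simpa [Finset.sum_range_succ] using this
  have hα := α_sq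
  have hprod : (α - 1 - (ε + ε ^ 2 + ε ^ 4)) * (α - 1 - (ε ^ 6 + ε ^ 5 + ε ^ 3)) = 0 := by
    linear_combination hα - (α - 1) * hsum + (3 + ε + ε ^ 2 + ε ^ 3) * h7 + hsum
  rcases mul_eq_zero.1 hprod with h | h
  · exact ⟨1, by norm_num, by linear_combination -h⟩
  · refine ⟨6, by norm_num, ?_⟩
    linear_combination -h + (ε ^ 5 + (ε ^ 17 + ε ^ 10 + ε ^ 3)) * h7

/-- The characteristic polynomial of `g₇` is `x³ - (α - 1) x² - α x - 1`, with the roots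
`ζ, ζ², ζ⁴`. -/
theorem charpoly_g₇_root {ζ : ℂ} (h7 : ζ ^ 7 = 1) (hne : ζ ≠ 1) (h : ζ + ζ ^ 2 + ζ ^ 4 = α - 1) :
    (mat (g₇ : G336) - ζ • 1).det = 0 := by
  have hα := α_sq
  have hsum : 1 + ζ + ζ ^ 2 + ζ ^ 3 + ζ ^ 4 + ζ ^ 5 + ζ ^ 6 = 0 := by
    refine mul_left_cancel₀ (sub_ne_zero.2 hne) ?_
    linear_combination h7
  have hdet : (mat (g₇ : G336) - ζ • 1).det = -(ζ ^ 3 - (α - 1) * ζ ^ 2 - α * ζ - 1) := by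
    rw [mat_g₇, Matrix.det_fin_three]
    simp
    grind
  rw [hdet, ← h]
  have : α = ζ + ζ ^ 2 + ζ ^ 4 + 1 := by linear_combination -h
  rw [this]
  linear_combination hsum

/-- An eigenbasis of `g₇`, whose eigenvalues are the powers of exponents 1, 2, 4 of a primitive
seventh root of unity. -/
theorem exists_eigenbasis_g₇ : ∃ e : ℕ, e.Coprime 7 ∧ ∃ b : Module.Basis (Fin 3) ℂ V,
    ∀ i, mat (g₇ : G336) *ᵥ b i = (ε ^ e) ^ (![1, 2, 4] i : ℕ) • b i := by
  obtain ⟨e, he, hs⟩ := exists_gauss_period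
  have hζ : IsPrimitiveRoot (ε ^ e) 7 := isPrimitiveRoot_ε.pow_of_coprime e he
  refine ⟨e, he, ?_⟩
  generalize ε ^ e = ζ at hs hζ
  have h7 := hζ.pow_eq_one
  have hinj : Function.Injective fun i : Fin 3 => ζ ^ (![1, 2, 4] i : ℕ) := by
    intro i j hij
    have h1 := hζ.pow_inj (i := ![1, 2, 4] i) (j := ![1, 2, 4] j)
      (by fin_cases i <;> simp) (by fin_cases j <;> simp) hij
    fin_cases i <;> fin_cases j <;> simp_all
  have hroot : ∀ i : Fin 3, ∃ v ≠ 0, mat (g₇ : G336) *ᵥ v = ζ ^ (![1, 2, 4] i : ℕ) • v := by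
    intro i
    have hdet : (mat (g₇ : G336) - ζ ^ (![1, 2, 4] i : ℕ) • 1).det = 0 := by
      refine charpoly_g₇_root ?_ ?_ ?_
      · rw [← pow_mul, mul_comm, pow_mul, h7, one_pow]
      · intro h
        have := (hζ.pow_eq_one_iff_dvd _).1 h
        fin_cases i <;> simp at this
      · fin_cases i
        · simpa using hs
        · simp
          linear_combination hs + ζ * h7
        · simp
          linear_combination hs + (ζ + ζ ^ 9 + ζ ^ 2) * h7
    obtain ⟨v, hv, hv'⟩ := Matrix.exists_mulVec_eq_zero_iff.2 hdet
    refine ⟨v, hv, ?_⟩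
    rw [Matrix.sub_mulVec, Matrix.smul_mulVec, Matrix.one_mulVec] at hv'
    exact sub_eq_zero.1 hv'
  choose v hv hv' using hroot
  have hli : LinearIndependent ℂ v :=
    Module.End.eigenvectors_linearIndependent' (Matrix.mulVecLin (mat (g₇ : G336))) _ hinj v
      fun i => ⟨Module.End.mem_eigenspace_iff.2 (hv' i), hv i⟩
  refine ⟨basisOfLinearIndependentOfCardEqFinrank hli (by simp), fun i => ?_⟩
  rw [coe_basisOfLinearIndependentOfCardEqFinrank]
  exact hv' i

/-! ### The topology of `J` -/

theorem one_le_norm_of_mem_O {x : ℂ} (hx : x ∈ O) (h0 : x ≠ 0) : 1 ≤ ‖x‖ := by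
  obtain ⟨a, b, rfl⟩ := hx
  set p : ℤ × ℤ := (a, b)
  have h1 : (codeNorm p : ℂ) = (‖decode p‖ : ℂ) ^ 2 := by
    rw [← Complex.conj_mul', conj_decode_mul]
    simp [codeNorm, decode, codeMul]
    ring
  have h2 : (codeNorm p : ℝ) = ‖decode p‖ ^ 2 := by exact_mod_cast h1
  have h3 : 0 < ‖decode p‖ := norm_pos_iff.2 h0
  have h4 : (1 : ℝ) ≤ codeNorm p := by
    have : 0 < (codeNorm p : ℝ) := by rw [h2]; positivity
    exact_mod_cast this
  change 1 ≤ ‖decode p‖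
  nlinarith

theorem one_le_norm_of_mem_Λ {z : V} (hz : z ∈ Λ) (h0 : z ≠ 0) : 1 ≤ ‖z‖ := by
  obtain ⟨i, hi⟩ := Function.ne_iff.1 h0
  exact (one_le_norm_of_mem_O (hz.1 i) hi).trans (norm_le_pi_norm z i)

/-- The lattice `Λ` is discrete and closed in `ℂ³`. -/
theorem eventually_mem_Λ (c : V) : ∀ᶠ d in 𝓝 c, d ∈ Λ → d = c := by
  by_cases h : ∃ d ∈ Λ, dist d c < 1 / 2 ∧ d ≠ c
  · obtain ⟨d₁, hd₁, hdist, hne⟩ := h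
    filter_upwards [Metric.ball_mem_nhds c (show (0 : ℝ) < 1 / 2 by norm_num),
      isOpen_ne.mem_nhds hne.symm] with d hd hdd hdΛ
    by_contra
    have h1 := one_le_norm_of_mem_Λ (Λ.sub_mem hdΛ hd₁) (sub_ne_zero.2 hdd)
    rw [← dist_eq_norm] at h1
    have := dist_triangle_right d d₁ c
    have := Metric.mem_ball.1 hd
    linarith
  · push Not at h
    filter_upwards [Metric.ball_mem_nhds c (show (0 : ℝ) < 1 / 2 by norm_num)] with d hd hdΛ
    exact h d hdΛ hd

theorem differentiable_mulVec (M : Matrix (Fin 3) (Fin 3) ℂ) :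
    Differentiable ℂ fun z : V => M *ᵥ z :=
  (Matrix.mulVecLin M).toContinuousLinearMap.differentiable

theorem smul_mk_eq (g : G336) (z : V) : g • (z : J) = ((mat g *ᵥ z : V) : J) := rfl

instance : ContinuousConstSMul G336 J where
  continuous_const_smul g := by
    have h : Continuous fun z : V => ((mat g *ᵥ z : V) : J) :=
      continuous_quotient_mk'.comp (differentiable_mulVec _).continuous
    exact (isQuotientMap_quotient_mk' (s := QuotientAddGroup.leftRel Λ)).continuous_iff.2 h

/-! ### The germs of the quotients of `J` -/

section Orbits

variable {Γ : Type*} [Group Γ] [MulAction Γ J]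

/-- The projection of `ℂ³` onto the quotient of `J` by a group. -/
abbrev orbitMk (Γ : Type*) [Group Γ] [MulAction Γ J] (z : V) : MulAction.orbitRel.Quotient Γ J :=
  Quotient.mk (MulAction.orbitRel Γ J) (z : J)

theorem orbitMk_eq_iff {ι : Γ →* G336} (hι : ∀ (g : Γ) (x : J), g • x = ι g • x) {z w : V} :
    orbitMk Γ z = orbitMk Γ w ↔ ∃ g, w - mat (ι g) *ᵥ z ∈ Λ := by
  rw [eq_comm, Quotient.eq, MulAction.orbitRel_apply]
  refine exists_congr fun g => ?_
  change g • (z : J) = (w : J) ↔ _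
  rw [hι, smul_mk_eq, eq_comm, mk_eq_mk_iff]

theorem continuous_orbitMk : Continuous (orbitMk Γ) :=
  continuous_quotient_mk'.comp continuous_quotient_mk'

theorem isOpenMap_orbitMk {ι : Γ →* G336} (hι : ∀ (g : Γ) (x : J), g • x = ι g • x) :
    IsOpenMap (orbitMk Γ) := by
  have : ContinuousConstSMul Γ J := ⟨fun g => by
    simp only [hι]
    exact continuous_const_smul (ι g)⟩
  exact (isOpenMap_quotient_mk'_mul (Γ := Γ) (T := J)).comp QuotientAddGroup.isOpenMap_coe

theorem hasHomogeneousFibers_orbitMk {ι : Γ →* G336} (hι : ∀ (g : Γ) (x : J), g • x = ι g • x) :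
    HasHomogeneousFibers (orbitMk Γ) := by
  intro z w h
  obtain ⟨g, hg⟩ := (orbitMk_eq_iff hι).1 h
  refine ⟨fun v => mat (ι g) *ᵥ v + (w - mat (ι g) *ᵥ z),
    (differentiable_mulVec _).add_const _, add_sub_cancel _ _, fun v => ?_⟩
  refine ((orbitMk_eq_iff hι).2 ⟨g, ?_⟩).symm
  simpa using hg

/-- Near a point `z₀` of `ℂ³`, only the elements of `G ⋉ Λ` that fix `z₀` identify points. -/
theorem eventually_sub_mulVec_mem_Λ (z₀ : V) : ∀ᶠ x : V × V in 𝓝 z₀ ×ˢ 𝓝 z₀, ∀ g : G336,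
    x.2 - mat g *ᵥ x.1 ∈ Λ → x.2 - mat g *ᵥ x.1 = z₀ - mat g *ᵥ z₀ := by
  rw [Filter.eventually_all]
  intro g
  rw [← nhds_prod_eq]
  have hc : Continuous fun x : V × V => x.2 - mat g *ᵥ x.1 := by
    have := (differentiable_mulVec (mat g)).continuous
    fun_prop
  exact (hc.tendsto (z₀, z₀)).eventually (eventually_mem_Λ _)

theorem mat_pow (g : G336) (n : ℕ) : mat (g ^ n) = mat g ^ n := by
  induction n with
  | zero => rfl
  | succ n ih => rw [pow_succ, pow_succ, mat_mul, ih]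

theorem mem_zpowers_of_smul {y : J} (h0 : y ≠ 0) (hy : g₇ • y = y) {g : G336} (hg : g • y = y) :
    ∃ n : ℕ, g = (g₇ : G336) ^ n := by
  have hyT : y ∈ T7 := (mem_T7_iff y).2 ⟨h0, g₇, orderOf_g₇, hy⟩
  have h1 : (⟨g, mem_H168_of_smul hyT hg⟩ : H168) ∈ MulAction.stabilizer H168 y := hg
  rw [(stabilizer_eq_zpowers hyT orderOf_g₇ hy).1] at h1
  obtain ⟨n, hn⟩ := mem_powers_iff_mem_zpowers.2 h1
  exact ⟨n, (congrArg Subtype.val hn).symm⟩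

/-- In coordinates that diagonalize `g₇`, the quotient of `J` by `G` or `H` at a nonzero fixed point
of `g₇` is the quotient of `ℂ³` by the cyclic group of order 7, because `g₇` generates the
stabilizer. -/
theorem germIso_orbit_cyclic {ι : Γ →* G336} (hι : ∀ (g : Γ) (x : J), g • x = ι g • x)
    {γ : Γ} (hγ : ι γ = g₇) {y : J} (h0 : y ≠ 0) (hy : g₇ • y = y) :
    GermIso (holJ.quotient (Quotient.mk (MulAction.orbitRel Γ J)))
      (Quotient.mk (MulAction.orbitRel Γ J) y)
      (cyclicHol 7 ![1, 2, 4]) (cyclicMk 7 ![1, 2, 4] 0) := by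
  obtain ⟨z₀, rfl⟩ := QuotientAddGroup.mk_surjective y
  obtain ⟨e, he, b, hb⟩ := exists_eigenbasis_g₇
  set M := b.equivFun.symm with hM
  have hact : ∀ (n : ℕ) (z : V), mat ((g₇ : G336) ^ n) *ᵥ M z =
      M (cyclicAct 7 ![1, 2, 4] (e * n) z) := by
    intro n z
    have hpow : ∀ i, mat ((g₇ : G336) ^ n) *ᵥ b i = ((ε ^ e) ^ (![1, 2, 4] i : ℕ)) ^ n • b i := by
      intro i
      rw [mat_pow]
      induction n with
      | zero => simp
      | succ n ih =>
        rw [pow_succ', ← Matrix.mulVec_mulVec, ih, Matrix.mulVec_smul, hb, ← mul_smul, pow_succ]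
    have hsum : ∀ z : V, M z = ∑ i, z i • b i := fun z => b.equivFun_symm_apply z
    rw [hsum, hsum, Matrix.mulVec_sum]
    refine Finset.sum_congr rfl fun i _ => ?_
    rw [Matrix.mulVec_smul, hpow, ← mul_smul]
    congr 1
    rw [mul_comm (z i)]
    refine congrArg (· * z i) ?_
    change _ = (ε ^ _) ^ _
    have hcast : (![1, 2, 4] : Fin 3 → ℤ) i = ((![1, 2, 4] i : ℕ) : ℤ) := by
      fin_cases i <;> rfl
    rw [hcast, zpow_natCast, ← Nat.cast_mul, zpow_natCast, ← pow_mul, ← pow_mul, ← pow_mul]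
    congr 1
    ring
  have hMd : Differentiable ℂ M := M.toLinearMap.toContinuousLinearMap.differentiable
  have hMd' : Differentiable ℂ M.symm := M.symm.toLinearMap.toContinuousLinearMap.differentiable
  let A : V ≃ V := M.toEquiv.trans (Equiv.addLeft z₀)
  have hA : ∀ z, A z = z₀ + M z := fun z => rfl
  have hAd : Differentiable ℂ A := hMd.const_add z₀
  have hAd' : Differentiable ℂ A.symm := hMd'.comp (differentiable_id.const_add (-z₀))
  let Ah : V ≃ₜ V := ⟨A, hAd.continuous, hAd'.continuous⟩
  have hA0 : A 0 = z₀ := by rw [hA, map_zero, add_zero]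
  have hfix : ∀ n : ℕ, z₀ - mat ((g₇ : G336) ^ n) *ᵥ z₀ ∈ Λ := by
    intro n
    rw [← mk_eq_mk_iff, ← smul_mk_eq]
    exact (smul_eq_of_mem_zpowers (Subgroup.npow_mem_zpowers g₇ n) hy).symm
  obtain ⟨t, ht, h⟩ := (Filter.eventually_prod_self_iff (r := fun x y : V => ∀ g : G336,
    y - mat g *ᵥ x ∈ Λ → y - mat g *ᵥ x = z₀ - mat g *ᵥ z₀)).1 (eventually_sub_mulVec_mem_Λ z₀)
  obtain ⟨B, hBt, hB, hzB⟩ := mem_nhds_iff.1 ht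
  have hgerm := germIso_of_fibers (q := orbitMk Γ ∘ A) (p := cyclicMk 7 ![1, 2, 4])
    (continuous_orbitMk.comp Ah.continuous) ((isOpenMap_orbitMk hι).comp Ah.isOpenMap) ?_
    continuous_cyclicMk isOpenMap_cyclicMk hasHomogeneousFibers_cyclicMk
    (hB.preimage Ah.continuous) (z₀ := 0) (by change A 0 ∈ B; rw [hA0]; exact hzB) ?_
  · rw [quotient_comp_equiv _ A hAd hAd'] at hgerm
    rw [Function.comp_apply, hA0] at hgerm
    exact hgerm
  · intro z w hzw
    obtain ⟨T, hT, hTz, hTq⟩ := hasHomogeneousFibers_orbitMk hι _ _ hzw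
    refine ⟨fun v => A.symm (T (A v)), hAd'.comp (hT.comp hAd), ?_, fun v => ?_⟩
    · simp [hTz]
    · simp [hTq]
  · intro z hz w hw
    rw [Function.comp_apply, Function.comp_apply, orbitMk_eq_iff hι, cyclicMk_eq_iff]
    constructor
    · rintro ⟨g, hg⟩
      have h1 := h _ (hBt hz) _ (hBt hw) (ι g) hg
      change A w - mat (ι g) *ᵥ A z = _ at h1
      have h2 : ι g • (z₀ : J) = z₀ := by
        rw [smul_mk_eq, eq_comm, mk_eq_mk_iff, ← h1]
        exact hg
      obtain ⟨n, hn⟩ := mem_zpowers_of_smul h0 hy h2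
      refine ⟨e * n, M.injective ?_⟩
      rw [← hact, ← hn]
      rw [hA, hA, Matrix.mulVec_add] at h1
      calc M w = (z₀ + M w - (mat (ι g) *ᵥ z₀ + mat (ι g) *ᵥ M z)) - z₀ + mat (ι g) *ᵥ z₀
            + mat (ι g) *ᵥ M z := by abel
        _ = mat (ι g) *ᵥ M z := by rw [h1]; abel
    · rintro ⟨k, rfl⟩
      obtain ⟨u, v, huv⟩ := Nat.isCoprime_iff_coprime.2 he
      -- the exponent of `g₇` is `k` times the inverse of `e` modulo 7
      obtain ⟨n, hn⟩ : ∃ n : ℕ, (e * n : ℤ) % 7 = k % 7 := by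
        refine ⟨((u * k) % 7).toNat, ?_⟩
        rw [Int.toNat_of_nonneg (by omega)]
        refine Int.ModEq.trans (b := e * (u * k)) ((Int.mod_modEq _ _).mul_left _) ?_
        refine (Int.modEq_iff_dvd.2 ⟨v * k, ?_⟩)
        push_cast at huv
        linear_combination -k * huv
      refine ⟨γ ^ n, ?_⟩
      have h1 : M (cyclicAct 7 ![1, 2, 4] k z) = mat ((g₇ : G336) ^ n) *ᵥ M z := by
        rw [hact, cyclicAct_mod k, cyclicAct_mod (e * n), hn]
      rw [map_pow, hγ, hA, hA, h1, Matrix.mulVec_add]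
      simpa using hfix n

end Orbits

/-! ### Images in the quotients -/

theorem fixedPoints_g₇ : {x : J | x ≠ 0 ∧ g₇ • x = x} = η '' Set.Icc 1 6 := by
  ext x
  constructor
  · rintro ⟨h0, hx⟩
    obtain ⟨k, hk, rfl⟩ := exists_nsmul_of_g₇_smul g₇_smul_η_one η_one_ne_zero hx
    have hk0 : k ≠ 0 := by
      rintro rfl
      exact h0 (zero_nsmul _)
    exact ⟨k, Set.mem_Icc.2 (by omega), η_eq_nsmul k⟩
  · rintro ⟨k, hk, rfl⟩
    have hk := Set.mem_Icc.1 hk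
    rw [η_eq_nsmul]
    refine ⟨fun h => ?_, g₇_smul_nsmul g₇_smul_η_one k⟩
    rw [← natCast_zsmul, zsmul_η_one_eq_zero] at h
    omega

theorem πY_eq_iff {x y : J} : πY x = πY y ↔ x ∈ MulAction.orbit H168 y := by
  rw [πY, πY, Quotient.eq, MulAction.orbitRel_apply]

theorem πX_eq_iff {x y : J} : πX x = πX y ↔ x ∈ MulAction.orbit G336 y := by
  rw [πX, πX, Quotient.eq, MulAction.orbitRel_apply]

theorem image_πY_T7 : πY '' T7 = {πY (η 1), πY (-η 1)} := by
  ext p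
  constructor
  · rintro ⟨x, hx, rfl⟩
    rw [T7_eq_union η_one_mem_T7] at hx
    rcases hx with hx | hx
    · exact Or.inl (πY_eq_iff.2 hx)
    · exact Or.inr (πY_eq_iff.2 hx)
  · rintro (rfl | rfl)
    · exact ⟨_, η_one_mem_T7, rfl⟩
    · exact ⟨_, neg_mem_T7 η_one_mem_T7, rfl⟩

theorem ncard_image_πY_T7 : (πY '' T7).ncard = 2 := by
  rw [image_πY_T7, Set.ncard_pair]
  intro h
  exact neg_notMem_orbit η_one_mem_T7 (πY_eq_iff.1 h.symm)

theorem image_πX_T7 : πX '' T7 = {πX (η 1)} := by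
  ext p
  constructor
  · rintro ⟨x, hx, rfl⟩
    rw [← orbit_G336 η_one_mem_T7] at hx
    exact πX_eq_iff.2 hx
  · rintro rfl
    exact ⟨_, η_one_mem_T7, rfl⟩

theorem isCyclicQuotientType_πY {x : J} (hx : x ∈ T7) :
    IsCyclicQuotientType holY (πY x) 7 ![1, 2, 4] := by
  obtain ⟨c, y, h0, hy, rfl⟩ := exists_conj_of_mem_T7 hx
  rw [πY_eq_iff.2 (MulAction.mem_orbit y c)]
  exact germIso_orbit_cyclic (Γ := H168) (ι := H168.subtype) (fun _ _ => rfl) (γ := g₇) rfl h0 hy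

theorem isCyclicQuotientType_πX : IsCyclicQuotientType holX (πX (η 1)) 7 ![1, 2, 4] :=
  germIso_orbit_cyclic (Γ := G336) (ι := MonoidHom.id G336) (fun _ _ => rfl) (γ := g₇) rfl
    η_one_ne_zero g₇_smul_η_one

theorem isLocal_holJ : holJ.IsLocal := (isLocal_stdHol 3).quotient _

end KleinQuotient

theorem proposition3 :
    T7.ncard = 48 ∧
    -- (i) stabilizers and orbits
    (∀ x ∈ T7, ∃ σ : H168, orderOf σ = 7 ∧ σ • x = x) ∧
    (∀ x ∈ T7, ∀ σ : H168, orderOf σ = 7 → σ • x = x →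
      MulAction.stabilizer H168 x = Subgroup.zpowers σ ∧
      Nat.card (MulAction.stabilizer H168 x) = 7) ∧
    (∃ x ∈ T7, ∃ y ∈ T7,
      T7 = MulAction.orbit H168 x ∪ MulAction.orbit H168 y ∧
      Disjoint (MulAction.orbit H168 x) (MulAction.orbit H168 y) ∧
      (MulAction.orbit H168 x).ncard = 24 ∧ (MulAction.orbit H168 y).ncard = 24) ∧
    -- (ii) the group `G₂₁`, the normalizers, doubling, representatives
    (Nat.card G21 = 21 ∧ g₇ ^ 7 = 1 ∧ h₃ ^ 3 = 1 ∧ h₃ * g₇ * h₃⁻¹ = g₇ ^ 2) ∧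
    (∀ σ : H168, orderOf σ = 7 →
      Nonempty (Subgroup.normalizer (Subgroup.zpowers σ : Set H168) ≃* G21) ∧
      ∃ τ ∈ Subgroup.normalizer (Subgroup.zpowers σ : Set H168), orderOf τ = 3 ∧
        ∀ x ∈ T7, σ • x = x → τ • x = 2 • x) ∧
    (∀ x ∈ T7,
      T7 = MulAction.orbit H168 x ∪ MulAction.orbit H168 (3 • x) ∧
      Disjoint (MulAction.orbit H168 x) (MulAction.orbit H168 (3 • x)) ∧
      2 • x ∈ MulAction.orbit H168 x ∧ 4 • x ∈ MulAction.orbit H168 x ∧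
      5 • x ∈ MulAction.orbit H168 (3 • x) ∧ 6 • x ∈ MulAction.orbit H168 (3 • x)) ∧
    {x : J | x ≠ 0 ∧ g₇ • x = x} = η '' Set.Icc 1 6 ∧
    (T7 = MulAction.orbit H168 (η 1) ∪ MulAction.orbit H168 (η 3) ∧
      Disjoint (MulAction.orbit H168 (η 1)) (MulAction.orbit H168 (η 3))) ∧
    -- (iii) the singularities of `Y = J / H₁₆₈`
    ((πY '' T7).ncard = 2 ∧
      ∀ p ∈ πY '' T7,
        IsIsolatedSingularity holY p ∧ IsCyclicQuotientType holY p 7 ![1, 2, 4]) ∧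
    -- (iv) the action of `-1` and the singularity of `X = J / G`
    (∀ x ∈ T7,
      (fun y : J => negOne • y) '' MulAction.orbit H168 x = T7 \ MulAction.orbit H168 x) ∧
    (∀ x ∈ T7, MulAction.orbit G336 x = T7) ∧
    (∃ p : X, πX '' T7 = {p} ∧
      IsIsolatedSingularity holX p ∧ IsCyclicQuotientType holX p 7 ![1, 2, 4]) := by
  have hη := η_one_mem_T7
  refine ⟨ncard_T7, fun x hx => ((mem_T7_iff x).1 hx).2,
    fun x hx σ hσ h => stabilizer_eq_zpowers hx hσ h,
    ⟨η 1, hη, -η 1, neg_mem_T7 hη, T7_eq_union hη, disjoint_orbit_neg hη, ncard_orbit hη,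
      ncard_orbit (neg_mem_T7 hη)⟩,
    ⟨card_G21, g₇_pow_seven, h₃_pow_three, h₃_mul_g₇⟩, fun σ hσ => normalizer_equiv hσ,
    fun x hx => ?_, fixedPoints_g₇, ?_, ⟨ncard_image_πY_T7, ?_⟩, fun x hx => negOne_image_orbit hx,
    fun x hx => orbit_G336 hx, πX (η 1), image_πX_T7,
    isIsolatedSingularity_cyclic.of_germIso (isLocal_holJ.quotient πX) isLocal_cyclicHol
      isCyclicQuotientType_πX, isCyclicQuotientType_πX⟩
  · have h2 := two_nsmul_mem_orbit_of_mem_T7 hx (MulAction.mem_orbit_self x)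
    have hn : ∀ k l : ℕ, k + l = 7 → k • x = -(l • x) := fun k l hkl => by
      rw [eq_neg_iff_add_eq_zero, ← add_smul, hkl, seven_nsmul_of_mem_T7 hx]
    rw [orbit_three_nsmul hx]
    refine ⟨T7_eq_union hx, disjoint_orbit_neg hx, h2, four_nsmul_mem_orbit hx, ?_, ?_⟩
    · rw [hn 5 2 rfl]
      exact neg_mem_orbit_neg h2
    · rw [hn 6 1 rfl, one_smul]
      exact MulAction.mem_orbit_self _
  · rw [η_eq_nsmul 3, orbit_three_nsmul hη]
    exact ⟨T7_eq_union hη, disjoint_orbit_neg hη⟩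
  · rintro _ ⟨x, hx, rfl⟩
    exact ⟨isIsolatedSingularity_cyclic.of_germIso (isLocal_holJ.quotient πY) isLocal_cyclicHol
      (isCyclicQuotientType_πY hx), isCyclicQuotientType_πY hx⟩
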